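/- Let $q$ be an odd prime power, let $1\le k\le d$ be integers, and let $\mathcal E=\mathcal A_1\times\cdots\times\mathcal A_d\subseteq\mathbb F_q^d$ with non-empty $\mathcal A_i\subseteq\mathbb F_q$. A $k$-simplex determined by $\mathcal E$ is an ordered $(k+1)$-tuple $(\mathbf x_1,\dots,\mathbf x_{k+1})$ of points of $\mathcal E$ (degenerate tuples are allowed); two $k$-simplices $(\mathbf x_i)$ and $(\mathbf y_i)$ are congruent if there are $\theta\in O(d,\mathbb F_q)$ (the orthogonal group of the form $\|\mathbf x\|=x_1^2+\dots+x_d^2$) and $\mathbf z\in\mathbb F_q^d$ with $\mathbf z+\theta(\mathbf x_i)=\mathbf y_i$ for all $i$. Let $T_{k,d}(\mathcal E)$ be the set of congruence classes of $k$-simplices determined by $\mathcal E$. (a) For all $d$, $k$ and every $C>0$ there is a constant $c=c(d,k,C)>0$ such that, for all $q$ and $\mathcal E$ as above, if $$\Big(\min_{1\le i\le d}|\mathcal A_i|\Big)^{-1}|\mathcal E|^{k+1}\ \ge\ C\,q^{kd},$$ then $|T_{k,d}(\mathcal E)|\ge c\,q^{\binom{k+1}{2}}$. (b) If $k<d$ and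 $q^{kd}=o\big(|\mathcal E|^{k+1}/\min_i|\mathcal A_i|\big)$, then $|T_{k,d}(\mathcal E)|\ge(1-o(1))\,q^{\binom{k+1}{2}}$. That is, for every $\varepsilon>0$ there is $\delta=\delta(d,k,\varepsilon)>0$ such that, for all $q$ and $\mathcal E$ as above, $q^{kd}\le\delta\,|\mathcal E|^{k+1}/\min_i|\mathcal A_i|$ implies $|T_{k,d}(\mathcal E)|\ge(1-\varepsilon)\,q^{\binom{k+1}{2}}$. (c) If $k=d$, then under the same hypothesis $|T_{k,d}(\mathcal E)|\ge(\tfrac12-o(1))\,q^{\binom{k+1}{2}}$, in the same sense. -/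

import Mathlib

universe u

/-- Two ordered `(k+1)`-tuples of points of `F^d` (the vertices of two `k`-simplices) are congruent
if `z + θ (x i) = y i` for all `i`, for some `z` in `F^d` and some `θ` in `O(d, F)`, the orthogonal
group of the standard form `∑ i, x i ^ 2`. -/
def SimplexCongruent {F : Type u} [Field F] {d k : ℕ} (x y : Fin (k + 1) → Fin d → F) : Prop :=
  ∃ θ ∈ Matrix.orthogonalGroup (Fin d) F, ∃ z : Fin d → F,
    ∀ i, z + Matrix.mulVec θ (x i) = y i

/-- Congruence of `k`-simplices in `F^d` is an equivalence relation. -/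
def simplexSetoid (F : Type u) [Field F] (d k : ℕ) : Setoid (Fin (k + 1) → Fin d → F) where
  r := SimplexCongruent
  iseqv :=
    { refl := fun x => ⟨1, one_mem _, 0, fun i => by simp⟩
      symm := by
        rintro x y ⟨θ, hθ, z, h⟩
        let _ : StarRing F := starRingOfComm
        have h1 : star θ * θ = 1 := (Matrix.mem_orthogonalGroup_iff' (Fin d) F).1 hθ
        refine ⟨star θ, Unitary.star_mem hθ, -(Matrix.mulVec (star θ) z), fun i => ?_⟩
        rw [← h i, Matrix.mulVec_add, Matrix.mulVec_mulVec, h1, Matrix.one_mulVec,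
          neg_add_cancel_left]
      trans := by
        rintro x y w ⟨θ, hθ, z, h⟩ ⟨η, hη, v, g⟩
        refine ⟨η * θ, mul_mem hη hθ, v + Matrix.mulVec η z, fun i => ?_⟩
        rw [← g i, ← h i, Matrix.mulVec_add, Matrix.mulVec_mulVec, add_assoc] }

/-- The number of congruence classes of `k`-simplices whose vertices all lie in `E`. -/
noncomputable def numSimplexClasses {F : Type u} [Field F] {d : ℕ} (k : ℕ)
    (E : Finset (Fin d → F)) : ℕ :=
  (Quotient.mk (simplexSetoid F d k) '' {x | ∀ i, x i ∈ E}).ncard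

/-!
Every simplex of the space is tested for being congruent to one in `E = ∏ A i`. Let `O` be the
orthogonal group, `q = #F`, and let `f w` be the number of rigid motions `x ↦ z + θ x` that map the
vertices of `w` into `E`. Then `∑ f w = #O * q ^ d * #E ^ (k + 1)`, and `∑ f w ^ 2` is
`#O * q ^ d` times the sum of `λ_θ(z) ^ (k + 1)` over all rigid motions, where `λ_θ(z)` is the
number of points of `E` that the motion maps into `E`. By Cauchy–Schwarz
(`card_mul_pow_le_card_congruentSimplices`) a good upper bound for this moment shows that many
simplices of the space are congruent to one in `E`.

Since `λ_θ(z) ≤ #E`, the moment of order `k + 1` is controlled by the mean and the variance of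
`λ_θ`. The variance is bounded in `sum_sum_congruenceCount_sq_le`. By Plancherel it is a sum over
frequencies `m ≠ 0` of `|Ê(m)|² |Ê(θᵀ m)|²`. Averaging over `θ` replaces the second factor by an
average over an orbit of `O`. Composing with reflections shows that the fibers of the orbit map are
small, so the average is at most a sum over the sphere of `m`, and neither Witt's theorem nor the
size of spheres is needed. What remains is the sum of `|Ê(m)|² |Ê(m')|²` over pairs of equal norm.
As `Ê` is a product of one-variable transforms, fixing all but one coordinate of `m'` leaves at most
two values for that coordinate, and Plancherel in each variable finishes the estimate.

It remains to pass from simplices to classes. The simplices with a degenerate Gram matrix are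
negligible. For the others, the edge vectors of congruent simplices have the same Gram matrix, and
`FlagNondegenerate.card_gram_fiber_mul_le` bounds the number of families with a given nondegenerate
Gram matrix, adding one vector at a time. The bound is asymptotically
`q ^ (d * k - (k + 1).choose 2)` for `k < d`, with an additional factor `2` for `k = d`, which is
the factor `1 / 2` lost in that case.
-/

open Finset Matrix

/-! ### Families with a nondegenerate Gram matrix -/

section

variable {F : Type u} [Field F] {d k : ℕ}

/-- The Gram matrix of the family `w` for the standard form is invertible. It is stated without
determinants: no nontrivial combination of the `w j` is orthogonal to all of them. In particular
`w` is linearly independent. -/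
def GramNondegenerate (w : Fin k → Fin d → F) : Prop :=
  ∀ c : Fin k → F, (∀ i, (∑ j, c j • w j) ⬝ᵥ w i = 0) → c = 0

/-- The Gram matrix of `w` acts surjectively. For `g i = x ⬝ᵥ w i` the solution is the orthogonal
projection of `x` to the span of `w`. -/
theorem GramNondegenerate.exists_orthogonal_projection {w : Fin k → Fin d → F}
    (hw : GramNondegenerate w) (g : Fin k → F) :
    ∃ c : Fin k → F, ∀ i, (∑ j, c j • w j) ⬝ᵥ w i = g i := by
  let Γ : (Fin k → F) →ₗ[F] (Fin k → F) :=
    { toFun := fun c i => (∑ j, c j • w j) ⬝ᵥ w i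
      map_add' := fun a b => by
        funext i; simp [add_smul, sum_add_distrib, add_dotProduct]
      map_smul' := fun a b => by
        funext i; simp [mul_smul, ← smul_sum, smul_dotProduct] }
  have hinj : Function.Injective Γ := by
    rw [← LinearMap.ker_eq_bot, LinearMap.ker_eq_bot']
    exact fun c hc => hw c fun i => congrFun hc i
  obtain ⟨c, hc⟩ := (LinearMap.injective_iff_surjective.1 hinj) g
  exact ⟨c, fun i => congrFun hc i⟩

theorem GramNondegenerate.congr {w v : Fin k → Fin d → F} (hw : GramNondegenerate w)
    (h : ∀ i j, v i ⬝ᵥ v j = w i ⬝ᵥ w j) : GramNondegenerate v := by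
  intro c hc
  refine hw c fun i => ?_
  rw [← hc i]
  simp only [sum_dotProduct, smul_dotProduct, h]

theorem GramNondegenerate.of_fin_zero (w : Fin 0 → Fin d → F) : GramNondegenerate w :=
  fun _ _ => Subsingleton.elim _ _

/-- Adding `x` to `w` keeps the Gram matrix invertible as soon as the component of `x` orthogonal
to `w` is anisotropic. -/
theorem GramNondegenerate.cons {w : Fin k → Fin d → F} (hw : GramNondegenerate w)
    {x : Fin d → F} {c : Fin k → F} (hc : ∀ i, (x - ∑ j, c j • w j) ⬝ᵥ w i = 0)
    (hx : (x - ∑ j, c j • w j) ⬝ᵥ (x - ∑ j, c j • w j) ≠ 0) :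
    GramNondegenerate (Fin.cons x w : Fin (k + 1) → Fin d → F) := by
  intro b hb
  set p := x - ∑ j, c j • w j with hp
  have hxp : x = p + ∑ j, c j • w j := by simp [hp]
  have h1 : (∑ j, b j • (Fin.cons x w : Fin (k + 1) → Fin d → F) j) =
      b 0 • x + ∑ j : Fin k, b j.succ • w j := by simp [Fin.sum_univ_succ]
  have hwi : ∀ i, (b 0 • x + ∑ j : Fin k, b j.succ • w j) ⬝ᵥ w i = 0 := fun i => by
    rw [← h1]; simpa using hb i.succ
  have hxx : (b 0 • x + ∑ j : Fin k, b j.succ • w j) ⬝ᵥ x = 0 := by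
    rw [← h1]; simpa using hb 0
  have hpp : (b 0 • x + ∑ j : Fin k, b j.succ • w j) ⬝ᵥ p = 0 := by
    rw [hp, dotProduct_sub, hxx, dotProduct_sum]
    simp [dotProduct_smul, hwi]
  have hwp : ∀ e : Fin k → F, (∑ j, e j • w j) ⬝ᵥ p = 0 := fun e => by
    rw [sum_dotProduct]
    exact sum_eq_zero fun j _ => by rw [smul_dotProduct, dotProduct_comm, hc j, smul_zero]
  have hb0 : b 0 = 0 := by
    have hxp' : x ⬝ᵥ p = p ⬝ᵥ p := by
      conv_lhs => rw [hxp]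
      rw [add_dotProduct, hwp, add_zero]
    rw [add_dotProduct, hwp, add_zero, smul_dotProduct, hxp', smul_eq_mul] at hpp
    exact (mul_eq_zero.1 hpp).resolve_right hx
  have htail : (fun j : Fin k => b j.succ) = 0 := by
    refine hw _ fun i => ?_
    simpa [hb0] using hwi i
  funext j
  refine Fin.cases hb0 (fun j => congrFun htail j) j

/-- A totally isotropic orthogonal complement of `w` would lie in the radical of the standard form,
since the complement and the span of `w` together generate the space. -/
theorem GramNondegenerate.exists_anisotropic (h2 : (2 : F) ≠ 0) {w : Fin k → Fin d → F}
    (hw : GramNondegenerate w) (hk : k < d) :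
    ∃ u : Fin d → F, (∀ i, u ⬝ᵥ w i = 0) ∧ u ⬝ᵥ u ≠ 0 := by
  by_contra! hiso
  have hker : LinearMap.ker (Matrix.mulVecLin (Matrix.of w)) ≠ ⊥ := by
    intro h
    have := LinearMap.finrank_le_finrank_of_injective (LinearMap.ker_eq_bot.1 h)
    simp at this
    omega
  obtain ⟨u, hu, hu0⟩ := Submodule.exists_mem_ne_zero_of_ne_bot hker
  have hperp : ∀ i, u ⬝ᵥ w i = 0 := fun i => by
    rw [dotProduct_comm]; exact congrFun (LinearMap.mem_ker.1 hu) i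
  refine hu0 (dotProduct_eq_zero u fun x => ?_)
  obtain ⟨c, hc⟩ := hw.exists_orthogonal_projection fun i => x ⬝ᵥ w i
  set p := x - ∑ j, c j • w j with hp
  have hpw : ∀ i, p ⬝ᵥ w i = 0 := fun i => by rw [hp, sub_dotProduct, hc, sub_self]
  have hup : u ⬝ᵥ p = 0 := by
    have := hiso (u + p) fun i => by rw [add_dotProduct, hperp, hpw, add_zero]
    rw [add_dotProduct, dotProduct_add, dotProduct_add, hiso u hperp, hiso p hpw,
      dotProduct_comm p u] at this
    have h : 2 * (u ⬝ᵥ p) = 0 := by linear_combination this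
    exact (mul_eq_zero.1 h).resolve_left h2
  have hx : x = p + ∑ j, c j • w j := by simp [hp]
  rw [hx, dotProduct_add, hup, dotProduct_sum]
  simp [dotProduct_smul, hperp]

open scoped Classical in
theorem card_quadratic_roots_le_two [Fintype F] {a : F} (ha : a ≠ 0) (b c : F) :
    #{s : F | a * s ^ 2 + b * s + c = 0} ≤ 2 := by
  by_contra! h
  obtain ⟨r, hr, s, hs, t, ht, hrs, hrt, hst⟩ := two_lt_card.1 h
  simp only [mem_filter, mem_univ, true_and] at hr hs ht
  have e1 : a * (r + s) + b = 0 :=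
    mul_left_cancel₀ (sub_ne_zero.2 hrs) (by linear_combination hr - hs)
  have e2 : a * (r + t) + b = 0 :=
    mul_left_cancel₀ (sub_ne_zero.2 hrt) (by linear_combination hr - ht)
  exact hst (mul_left_cancel₀ ha (by linear_combination e1 - e2))

open scoped Classical in
/-- If `U` contains every line with direction `u` through a point of `Z`, and each such line meets
`Z` in at most `m` points, then `Z` has relative size at most `m / q` in `U`. -/
theorem card_mul_card_le_of_lines [Fintype F] {Z U : Finset (Fin d → F)} (u : Fin d → F) (m : ℕ)
    (hU : ∀ z ∈ Z, ∀ s : F, z + s • u ∈ U)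
    (hm : ∀ y ∈ U, #{s : F | y + s • u ∈ Z} ≤ m) :
    Fintype.card F * #Z ≤ m * #U := by
  have hmaps : ∀ p ∈ (univ : Finset F) ×ˢ Z, p.2 + (-p.1) • u ∈ U := fun p hp =>
    hU _ (mem_product.1 hp).2 _
  have := card_le_mul_card_image_of_maps_to hmaps m fun y hy => by
    refine le_trans ?_ (hm y hy)
    refine card_le_card_of_injOn Prod.fst ?_ ?_
    · rintro ⟨s, z⟩ hp
      simp only [coe_filter, mem_product, mem_univ, true_and, Set.mem_ofPred_eq] at hp ⊢
      rw [← hp.2]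
      simpa using hp.1
    · rintro ⟨s, z⟩ hp ⟨s', z'⟩ hp' (rfl : s = s')
      simp only [coe_filter, mem_product, mem_univ, true_and, Set.mem_ofPred_eq] at hp hp'
      rw [add_right_cancel (hp.2.trans hp'.2.symm)]
  simpa using this

open scoped Classical in
theorem GramNondegenerate.card_orthogonal_mul [Fintype F] {w : Fin k → Fin d → F}
    (hw : GramNondegenerate w) :
    #{u : Fin d → F | ∀ i, u ⬝ᵥ w i = 0} * Fintype.card F ^ k = Fintype.card F ^ d := by
  have hsurj : Function.Surjective (Matrix.mulVecLin (Matrix.of w)) := fun g => by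
    obtain ⟨c, hc⟩ := hw.exists_orthogonal_projection g
    refine ⟨∑ j, c j • w j, funext fun i => ?_⟩
    rw [← hc i, dotProduct_comm]
    rfl
  have hrank := LinearMap.finrank_range_add_finrank_ker (Matrix.mulVecLin (Matrix.of w))
  rw [LinearMap.range_eq_top.2 hsurj, finrank_top] at hrank
  simp only [Module.finrank_fintype_fun_eq_card, Fintype.card_fin] at hrank
  have hcard : #{u : Fin d → F | ∀ i, u ⬝ᵥ w i = 0} =
      Fintype.card (LinearMap.ker (Matrix.mulVecLin (Matrix.of w))) := by
    rw [← Fintype.card_coe]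
    refine Fintype.card_congr (Equiv.subtypeEquivRight fun u => ?_)
    simp only [mem_filter, mem_univ, true_and, LinearMap.mem_ker, funext_iff]
    refine forall_congr' fun i => ?_
    rw [dotProduct_comm]
    rfl
  rw [hcard, Module.card_eq_pow_finrank (K := F), ← pow_add, add_comm, hrank]

open scoped Classical in
theorem GramNondegenerate.card_isotropic_mul_le [Fintype F] (h2 : (2 : F) ≠ 0)
    {w : Fin k → Fin d → F} (hw : GramNondegenerate w) (hk : k < d) :
    Fintype.card F * #{u : Fin d → F | (∀ i, u ⬝ᵥ w i = 0) ∧ u ⬝ᵥ u = 0} ≤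
      2 * #{u : Fin d → F | ∀ i, u ⬝ᵥ w i = 0} := by
  obtain ⟨v, hv, hvv⟩ := hw.exists_anisotropic h2 hk
  refine card_mul_card_le_of_lines v 2 ?_ ?_
  · intro z hz s
    simp only [mem_filter, mem_univ, true_and] at hz ⊢
    intro i
    rw [add_dotProduct, smul_dotProduct, hz.1, hv, smul_zero, add_zero]
  · intro y _
    refine le_trans (card_le_card fun s hs => ?_)
      (card_quadratic_roots_le_two hvv (2 * (y ⬝ᵥ v)) (y ⬝ᵥ y))
    simp only [mem_filter, mem_univ, true_and] at hs ⊢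
    have := hs.2
    simp only [add_dotProduct, dotProduct_add, smul_dotProduct, dotProduct_smul, smul_eq_mul,
      dotProduct_comm v y] at this
    linear_combination this

open scoped Classical in
/-- On a line whose direction is an anisotropic vector orthogonal to `w`, the norm of the component
orthogonal to `w` is a quadratic polynomial, so at most two points of the line can be degenerate
extensions of `w`. -/
theorem GramNondegenerate.card_degenerate_cons_mul_le [Fintype F] (h2 : (2 : F) ≠ 0)
    {w : Fin k → Fin d → F} (hw : GramNondegenerate w) (hk : k < d) :
    Fintype.card F *
        #{x : Fin d → F | ¬ GramNondegenerate (Fin.cons x w : Fin (k + 1) → Fin d → F)} ≤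
      2 * Fintype.card F ^ d := by
  obtain ⟨v, hv, hvv⟩ := hw.exists_anisotropic h2 hk
  have := card_mul_card_le_of_lines (U := univ) (Z := {x : Fin d → F |
    ¬ GramNondegenerate (Fin.cons x w : Fin (k + 1) → Fin d → F)}) v 2 (by simp) ?_
  · simpa using this
  · intro y _
    obtain ⟨c, hc⟩ := hw.exists_orthogonal_projection fun i => y ⬝ᵥ w i
    set p := y - ∑ j, c j • w j with hp
    -- Moving `y` by `s • v` leaves its projection to the span of `w` unchanged.
    refine le_trans (card_le_card fun s hs => ?_)
      (card_quadratic_roots_le_two hvv (2 * (p ⬝ᵥ v)) (p ⬝ᵥ p))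
    simp only [mem_filter, mem_univ, true_and] at hs ⊢
    by_contra hne
    have hps : y + s • v - ∑ j, c j • w j = p + s • v := by rw [hp]; abel
    refine hs (hw.cons (c := c) (fun i => ?_) ?_)
    · rw [hps, add_dotProduct, smul_dotProduct, hv, hp, sub_dotProduct, hc]; simp
    · rw [hps]
      intro h0
      apply hne
      simp only [add_dotProduct, dotProduct_add, smul_dotProduct, dotProduct_smul, smul_eq_mul,
        dotProduct_comm v p] at h0
      linear_combination h0

/-- Every final segment of the family `w` has an invertible Gram matrix, so that `w` can be built up
one vector at a time without meeting a degenerate form. -/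
def FlagNondegenerate : ∀ {k : ℕ}, (Fin k → Fin d → F) → Prop
  | 0, _ => True
  | _ + 1, w => FlagNondegenerate (Fin.tail w) ∧ GramNondegenerate w

theorem FlagNondegenerate.gramNondegenerate :
    ∀ {k : ℕ} {w : Fin k → Fin d → F}, FlagNondegenerate w → GramNondegenerate w
  | 0, w, _ => .of_fin_zero w
  | _ + 1, _, h => h.2

open scoped Classical in
theorem card_not_flagNondegenerate_mul_le [Fintype F] (h2 : (2 : F) ≠ 0) (hk : k ≤ d) :
    Fintype.card F * #{w : Fin k → Fin d → F | ¬ FlagNondegenerate w} ≤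
      2 * k * Fintype.card F ^ (d * k) := by
  induction k with
  | zero => simp [FlagNondegenerate]
  | succ k ih =>
    have ih := ih (by omega)
    set q := Fintype.card F
    have hsub : #{w : Fin (k + 1) → Fin d → F | ¬ FlagNondegenerate w} ≤
        ∑ w : Fin k → Fin d → F, #{x : Fin d → F |
          ¬ FlagNondegenerate (Fin.cons x w : Fin (k + 1) → Fin d → F)} := by
      rw [card_eq_sum_card_fiberwise (f := Fin.tail) (t := univ) (by simp)]
      refine sum_le_sum fun w _ => ?_
      refine card_le_card_of_injOn (fun v => v 0) ?_ ?_
      · intro v hv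
        simp only [coe_filter, mem_filter, mem_univ, true_and, Set.mem_ofPred_eq] at hv ⊢
        rw [← hv.2, Fin.cons_self_tail]
        exact hv.1
      · intro v hv v' hv' h
        simp only [coe_filter, mem_filter, mem_univ, true_and, Set.mem_ofPred_eq] at hv hv' h
        rw [← Fin.cons_self_tail v, ← Fin.cons_self_tail v', hv.2, hv'.2, h]
    have hterm : ∀ w : Fin k → Fin d → F, q * #{x : Fin d → F |
        ¬ FlagNondegenerate (Fin.cons x w : Fin (k + 1) → Fin d → F)} ≤
        2 * q ^ d + q ^ d * (q * if ¬ FlagNondegenerate w then 1 else 0) := by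
      intro w
      by_cases hw : FlagNondegenerate w
      · refine le_trans (le_of_eq ?_) (le_trans
          (hw.gramNondegenerate.card_degenerate_cons_mul_le h2 (by omega)) (Nat.le_add_right _ _))
        simp only [FlagNondegenerate, Fin.tail_cons, hw, true_and]
        rfl
      · refine le_trans (Nat.mul_le_mul_left q (card_le_univ _)) ?_
        simp only [hw, Fintype.card_fun, Fintype.card_fin, not_false_eq_true, if_true]
        nlinarith [Nat.zero_le (q ^ d)]
    calc q * #{w : Fin (k + 1) → Fin d → F | ¬ FlagNondegenerate w}
        ≤ ∑ w : Fin k → Fin d → F, q * #{x : Fin d → F |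
          ¬ FlagNondegenerate (Fin.cons x w : Fin (k + 1) → Fin d → F)} := by
          rw [← mul_sum]; exact Nat.mul_le_mul_left _ hsub
      _ ≤ ∑ w : Fin k → Fin d → F,
          (2 * q ^ d + q ^ d * (q * if ¬ FlagNondegenerate w then 1 else 0)) :=
          sum_le_sum fun w _ => hterm w
      _ = 2 * q ^ d * q ^ (d * k) +
          q ^ d * (q * #{w : Fin k → Fin d → F | ¬ FlagNondegenerate w}) := by
          simp only [sum_add_distrib, ← mul_sum, card_filter]
          simp only [sum_const, card_univ, Fintype.card_fun, Fintype.card_fin,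
            smul_eq_mul, pow_mul, q]
          ring
      _ ≤ 2 * q ^ d * q ^ (d * k) + q ^ d * (2 * k * q ^ (d * k)) := by gcongr
      _ = 2 * (k + 1) * q ^ (d * (k + 1)) := by ring

open scoped Classical in
/-- Every line through `x₀` with an anisotropic direction has at most one further point with the
same norm as `x₀`, so at most one nonzero multiple of each direction is counted on the left. -/
theorem card_anisotropic_chords_mul_le [Fintype F] (w : Fin k → Fin d → F) (x₀ : Fin d → F) :
    (Fintype.card F - 1) * #{u : Fin d → F | (∀ i, u ⬝ᵥ w i = 0) ∧ u ⬝ᵥ u ≠ 0 ∧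
        u ⬝ᵥ u + 2 * (x₀ ⬝ᵥ u) = 0} ≤
      #{u : Fin d → F | ∀ i, u ⬝ᵥ w i = 0} - 1 := by
  have hcard : #((univ : Finset F).erase 0) = Fintype.card F - 1 := by simp [card_univ]
  have hcard' : #(({u : Fin d → F | ∀ i, u ⬝ᵥ w i = 0} : Finset (Fin d → F)).erase 0) =
      #{u : Fin d → F | ∀ i, u ⬝ᵥ w i = 0} - 1 := card_erase_of_mem (by simp)
  rw [← hcard, ← hcard', ← card_product]
  refine card_le_card_of_injOn (fun p => p.1 • p.2) ?_ ?_
  · rintro ⟨c, u⟩ hp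
    simp only [coe_product, Set.mem_prod, mem_coe, mem_erase, mem_univ, and_true, mem_filter,
      true_and, ne_eq] at hp ⊢
    obtain ⟨hc, hu, huu, -⟩ := hp
    refine ⟨smul_ne_zero hc ?_, fun i => by rw [smul_dotProduct, hu, smul_zero]⟩
    rintro rfl
    simp at huu
  · rintro ⟨c, u⟩ hp ⟨c', u'⟩ hp' (h : c • u = c' • u')
    simp only [coe_product, Set.mem_prod, mem_coe, mem_erase, mem_univ, and_true, mem_filter,
      true_and, ne_eq] at hp hp'
    obtain ⟨hc, hu, huu, hx⟩ := hp
    obtain ⟨hc', hu', huu', hx'⟩ := hp'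
    have hs : u' = (c'⁻¹ * c) • u := by rw [mul_smul, h, smul_smul, inv_mul_cancel₀ hc', one_smul]
    have hs0 : c'⁻¹ * c ≠ 0 := mul_ne_zero (inv_ne_zero hc') hc
    rw [hs] at hx'
    simp only [smul_dotProduct, dotProduct_smul, smul_eq_mul] at hx'
    have h1 : (c'⁻¹ * c) * (u ⬝ᵥ u) * (c'⁻¹ * c - 1) = 0 := by
      linear_combination hx' - (c'⁻¹ * c) * hx
    have h2 : c'⁻¹ * c = 1 :=
      sub_eq_zero.1 ((mul_eq_zero.1 h1).resolve_left (mul_ne_zero hs0 huu))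
    have h3 : c = c' := by
      rw [← mul_one c', ← h2, mul_inv_cancel_left₀ hc']
    rw [hs, h2, one_smul, h3]

open scoped Classical in
/-- A vector with the same products with `w` and the same norm as `x₀` is `x₀ + u` with `u`
orthogonal to `w`. Either `u` is anisotropic, or it is isotropic and then also orthogonal
to `x₀`. -/
theorem card_extensions_le [Fintype F] (h2 : (2 : F) ≠ 0) (w : Fin k → Fin d → F)
    (x₀ : Fin d → F) :
    #{x : Fin d → F | (∀ i, x ⬝ᵥ w i = x₀ ⬝ᵥ w i) ∧ x ⬝ᵥ x = x₀ ⬝ᵥ x₀} ≤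
      #{u : Fin d → F | (∀ i, u ⬝ᵥ w i = 0) ∧ u ⬝ᵥ u ≠ 0 ∧ u ⬝ᵥ u + 2 * (x₀ ⬝ᵥ u) = 0} +
      #{u : Fin d → F | (∀ i, u ⬝ᵥ (Fin.cons x₀ w : Fin (k + 1) → Fin d → F) i = 0) ∧
        u ⬝ᵥ u = 0} := by
  refine le_trans (card_le_card_of_injOn (fun x => x - x₀) (t := _ ∪ _) ?_
    (sub_left_injective.injOn)) (card_union_le _ _)
  intro x hx
  simp only [coe_filter, mem_univ, true_and, Set.mem_ofPred_eq, coe_union, Set.mem_union] at hx ⊢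
  have hu : ∀ i, (x - x₀) ⬝ᵥ w i = 0 := fun i => by rw [sub_dotProduct, hx.1, sub_self]
  have hq : (x - x₀) ⬝ᵥ (x - x₀) + 2 * (x₀ ⬝ᵥ (x - x₀)) = 0 := by
    simp only [sub_dotProduct, dotProduct_sub, dotProduct_comm x₀ x]
    linear_combination hx.2
  by_cases h : (x - x₀) ⬝ᵥ (x - x₀) = 0
  · refine Or.inr ⟨Fin.cases ?_ hu, h⟩
    rw [h, zero_add] at hq
    rw [Fin.cons_zero, dotProduct_comm]
    exact (mul_eq_zero.1 hq).resolve_left h2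
  · exact Or.inl ⟨hu, h, hq⟩

open scoped Classical in
/-- The number of ways to extend `w` by a vector with prescribed products is at most
`(1 + 4 / q) * q ^ (d - k - 1)`. In the last dimension, where the orthogonal complement of `w` is a
line, a reflection may give a second solution, and the bound is `2`. -/
theorem card_extensions_mul_le [Fintype F] (h2 : (2 : F) ≠ 0) {w : Fin k → Fin d → F}
    {x₀ : Fin d → F} (hw : GramNondegenerate w)
    (hx : GramNondegenerate (Fin.cons x₀ w : Fin (k + 1) → Fin d → F)) (hk : k + 1 ≤ d) :
    (#{x : Fin d → F | (∀ i, x ⬝ᵥ w i = x₀ ⬝ᵥ w i) ∧ x ⬝ᵥ x = x₀ ⬝ᵥ x₀} : ℝ) *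
        (Fintype.card F : ℝ) ^ (k + 1) ≤
      (if k + 1 < d then 1 + 4 / (Fintype.card F : ℝ) else 2) * (Fintype.card F : ℝ) ^ d := by
  have hN := card_extensions_le h2 w x₀
  have hS1 := card_anisotropic_chords_mul_le w x₀
  have hD := hw.card_orthogonal_mul
  have hD' := hx.card_orthogonal_mul
  have hq2 : 2 ≤ Fintype.card F := Fintype.one_lt_card
  set q := Fintype.card F
  set N := #{x : Fin d → F | (∀ i, x ⬝ᵥ w i = x₀ ⬝ᵥ w i) ∧ x ⬝ᵥ x = x₀ ⬝ᵥ x₀}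
  set S1 := #{u : Fin d → F | (∀ i, u ⬝ᵥ w i = 0) ∧ u ⬝ᵥ u ≠ 0 ∧ u ⬝ᵥ u + 2 * (x₀ ⬝ᵥ u) = 0}
  set S2 := #{u : Fin d → F |
    (∀ i, u ⬝ᵥ (Fin.cons x₀ w : Fin (k + 1) → Fin d → F) i = 0) ∧ u ⬝ᵥ u = 0} with hS2d
  set D := #{u : Fin d → F | ∀ i, u ⬝ᵥ w i = 0}
  set D' := #{u : Fin d → F | ∀ i, u ⬝ᵥ (Fin.cons x₀ w : Fin (k + 1) → Fin d → F) i = 0} with hD'd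
  have hq0 : 0 < q := by omega
  split_ifs with hkd
  · have hS2 : q * S2 ≤ 2 * D' := hx.card_isotropic_mul_le h2 hkd
    have hN : (N : ℝ) ≤ S1 + S2 := by exact_mod_cast hN
    have hq2 : (2 : ℝ) ≤ q := by exact_mod_cast hq2
    have hS1 : ((q : ℝ) - 1) * S1 ≤ D := by
      have : (q - 1) * S1 ≤ D := hS1.trans (Nat.sub_le _ _)
      have h : (((q - 1 : ℕ) : ℝ)) * S1 ≤ D := by exact_mod_cast this
      rwa [Nat.cast_sub (by omega), Nat.cast_one] at h
    have hS2 : (q : ℝ) * S2 ≤ 2 * D' := by exact_mod_cast hS2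
    have hD : (D : ℝ) * q ^ k = q ^ d := by exact_mod_cast hD
    have hD' : (D' : ℝ) * q ^ (k + 1) = q ^ d := by exact_mod_cast hD'
    have hq : (0 : ℝ) < q := by linarith
    have e1 : (S1 : ℝ) * q ^ (k + 1) ≤ (1 + 2 / q) * q ^ d := by
      have h1 : (S1 : ℝ) * q ≤ (1 + 2 / q) * D := by
        have h3 : (q : ℝ) ≤ (1 + 2 / q) * (q - 1) := by
          have : (1 + 2 / (q : ℝ)) * (q - 1) = q + (1 - 2 / q) := by field_simp; ring
          rw [this]
          have : 2 / (q : ℝ) ≤ 1 := by rw [div_le_one hq]; exact hq2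
          linarith
        calc (S1 : ℝ) * q ≤ S1 * ((1 + 2 / q) * (q - 1)) := by gcongr
          _ = (1 + 2 / q) * ((q - 1) * S1) := by ring
          _ ≤ _ := by gcongr
      calc (S1 : ℝ) * q ^ (k + 1) = (S1 * q) * q ^ k := by ring
        _ ≤ ((1 + 2 / q) * D) * q ^ k := by gcongr
        _ = _ := by rw [mul_assoc, hD]
    have e2 : (S2 : ℝ) * q ^ (k + 1) ≤ 2 / q * q ^ d := by
      rw [← hD', div_mul_eq_mul_div, le_div_iff₀ hq]
      calc (S2 : ℝ) * q ^ (k + 1) * q = (q * S2) * q ^ (k + 1) := by ring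
        _ ≤ (2 * D') * q ^ (k + 1) := by gcongr
        _ = _ := by ring
    calc (N : ℝ) * q ^ (k + 1) ≤ (S1 + S2) * q ^ (k + 1) := by gcongr
      _ = S1 * q ^ (k + 1) + S2 * q ^ (k + 1) := by ring
      _ ≤ (1 + 2 / q) * q ^ d + 2 / q * q ^ d := add_le_add e1 e2
      _ = _ := by ring
  · obtain rfl : k + 1 = d := by omega
    -- The complement of `w` is a line and that of `x₀` together with `w` is zero.
    have hDq : D = q := Nat.eq_of_mul_eq_mul_right (pow_pos hq0 k) (by rw [hD]; ring)
    have hD1 : D' = 1 := Nat.eq_of_mul_eq_mul_right (pow_pos hq0 (k + 1)) (by rw [hD', one_mul])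
    have hS1 : S1 ≤ 1 := by
      rw [hDq] at hS1
      exact Nat.le_of_mul_le_mul_left (by simpa using hS1) (show 0 < q - 1 by omega)
    have hS2 : S2 ≤ 1 := by
      rw [← hD1]
      exact card_le_card fun u hu => by
        simp only [mem_filter, mem_univ, true_and] at hu ⊢; exact hu.1
    have : (N : ℝ) ≤ 2 := by exact_mod_cast (by omega : N ≤ 2)
    gcongr

theorem FlagNondegenerate.congr : ∀ {k : ℕ} {w v : Fin k → Fin d → F}, FlagNondegenerate w →
    (∀ i j, v i ⬝ᵥ v j = w i ⬝ᵥ w j) → FlagNondegenerate v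
  | 0, _, _, _, _ => trivial
  | _ + 1, _, _, h, hvw => ⟨h.1.congr fun i j => hvw i.succ j.succ, h.2.congr hvw⟩

open scoped Classical in
/-- The Gram matrix of a family all of whose final segments are nondegenerate is realized by at most
`(1 + O(1 / q)) * q ^ (d * k - (k + 1).choose 2)` families if `k < d`, and by at most twice as
many if `k = d`. The factor `2` is what remains of the orthogonal group of a line. -/
theorem FlagNondegenerate.card_gram_fiber_mul_le [Fintype F] (h2 : (2 : F) ≠ 0)
    {v : Fin k → Fin d → F} (hv : FlagNondegenerate v) (hk : k ≤ d) :
    (#{w : Fin k → Fin d → F | ∀ i j, w i ⬝ᵥ w j = v i ⬝ᵥ v j} : ℝ) *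
        (Fintype.card F : ℝ) ^ (k + 1).choose 2 ≤
      (if k < d then 1 else 2) * (1 + 4 / (Fintype.card F : ℝ)) ^ k *
        (Fintype.card F : ℝ) ^ (d * k) := by
  induction k with
  | zero =>
    split_ifs <;> simp
  | succ k ih =>
    have ih := ih hv.1 (by omega)
    rw [if_pos (by omega), one_mul] at ih
    set q : ℝ := (Fintype.card F : ℝ) with hqd
    have hq : 0 < q := by rw [hqd]; exact_mod_cast Fintype.card_pos
    set B : ℝ := (if k + 1 < d then 1 + 4 / q else 2) * q ^ d with hB
    have hB0 : 0 ≤ B := by rw [hB]; split_ifs <;> positivity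
    have hsum : (#{w : Fin (k + 1) → Fin d → F | ∀ i j, w i ⬝ᵥ w j = v i ⬝ᵥ v j} : ℝ) *
        q ^ (k + 1) ≤
        #{w : Fin k → Fin d → F | ∀ i j, w i ⬝ᵥ w j = Fin.tail v i ⬝ᵥ Fin.tail v j} * B := by
      rw [card_eq_sum_card_fiberwise (f := Fin.tail)
        (t := {w : Fin k → Fin d → F | ∀ i j, w i ⬝ᵥ w j = Fin.tail v i ⬝ᵥ Fin.tail v j})]
      · rw [Nat.cast_sum, sum_mul, ← nsmul_eq_mul]
        refine sum_le_card_nsmul _ _ _ fun w hw => ?_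
        simp only [mem_filter, mem_univ, true_and] at hw
        rcases Finset.eq_empty_or_nonempty ({u ∈ ({w : Fin (k + 1) → Fin d → F |
          ∀ i j, w i ⬝ᵥ w j = v i ⬝ᵥ v j} : Finset _) | Fin.tail u = w}) with he | ⟨u, hu⟩
        · rw [he]; simpa using hB0
        · simp only [mem_filter, mem_univ, true_and] at hu
          obtain ⟨hu, rfl⟩ := hu
          have hflag := hv.congr hu
          have hext := card_extensions_mul_le h2 hflag.1.gramNondegenerate
            (x₀ := u 0) (by rw [Fin.cons_self_tail]; exact hflag.2) hk
          refine le_trans ?_ hext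
          gcongr
          refine card_le_card_of_injOn (fun x => x 0) ?_ ?_
          · intro x hx
            simp only [coe_filter, mem_filter, mem_univ, true_and, Set.mem_ofPred_eq] at hx ⊢
            refine ⟨fun i => ?_, by rw [hx.1, hu]⟩
            rw [← hx.2]
            exact (hx.1 0 i.succ).trans ((hu 0 i.succ).symm.trans (by
              rw [show u i.succ = Fin.tail u i from rfl, ← hx.2]))
          · intro x hx y hy h
            simp only [coe_filter, mem_filter, mem_univ, true_and, Set.mem_ofPred_eq] at hx hy h
            rw [← Fin.cons_self_tail x, ← Fin.cons_self_tail y, hx.2, hy.2, h]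
      · intro w hw
        simp only [coe_filter, mem_univ, true_and, Set.mem_ofPred_eq] at hw ⊢
        exact fun i j => hw i.succ j.succ
    have hch : (k + 1 + 1).choose 2 = (k + 1) + (k + 1).choose 2 := by
      rw [Nat.choose_succ_succ' (k + 1) 1, Nat.choose_one_right]
    rw [hch, pow_add, ← mul_assoc]
    have hBle : B ≤ (if k + 1 < d then 1 else 2) * (1 + 4 / q) * q ^ d := by
      rw [hB]
      gcongr
      split_ifs
      · rw [one_mul]
      · have : 0 ≤ 4 / q := by positivity
        linarith
    calc _ ≤ (#{w : Fin k → Fin d → F | ∀ i j, w i ⬝ᵥ w j = Fin.tail v i ⬝ᵥ Fin.tail v j} * B) *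
          q ^ (k + 1).choose 2 := by gcongr
      _ = (#{w : Fin k → Fin d → F | ∀ i j, w i ⬝ᵥ w j = Fin.tail v i ⬝ᵥ Fin.tail v j} *
          q ^ (k + 1).choose 2) * B := by ring
      _ ≤ ((1 + 4 / q) ^ k * q ^ (d * k)) *
          ((if k + 1 < d then 1 else 2) * (1 + 4 / q) * q ^ d) := by gcongr
      _ = _ := by ring

end

/-! ### The orthogonal group and reflections -/

section

variable {F : Type u} [Field F] {d k : ℕ}

open scoped Classical in
/-- The orthogonal group of the standard form as a finset of matrices, so that sums over it need no
group structure. -/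
noncomputable def orthogonalFinset (F : Type u) [Field F] [Fintype F] (d : ℕ) :
    Finset (Matrix (Fin d) (Fin d) F) := {θ | θᵀ * θ = 1}

section
variable [Fintype F]

theorem mem_orthogonalFinset {θ : Matrix (Fin d) (Fin d) F} :
    θ ∈ orthogonalFinset F d ↔ θᵀ * θ = 1 := by
  simp [orthogonalFinset]

theorem mem_orthogonalGroup_iff_mem_orthogonalFinset {θ : Matrix (Fin d) (Fin d) F} :
    θ ∈ Matrix.orthogonalGroup (Fin d) F ↔ θ ∈ orthogonalFinset F d := by
  rw [mem_orthogonalFinset, Matrix.mem_orthogonalGroup_iff']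

theorem transpose_mem_orthogonalFinset {θ : Matrix (Fin d) (Fin d) F}
    (h : θ ∈ orthogonalFinset F d) : θᵀ ∈ orthogonalFinset F d := by
  rw [mem_orthogonalFinset] at h ⊢
  rw [transpose_transpose]
  exact mul_eq_one_comm.1 h

theorem mul_mem_orthogonalFinset {θ η : Matrix (Fin d) (Fin d) F}
    (hθ : θ ∈ orthogonalFinset F d) (hη : η ∈ orthogonalFinset F d) :
    θ * η ∈ orthogonalFinset F d := by
  rw [mem_orthogonalFinset] at *
  rw [transpose_mul, Matrix.mul_assoc, ← Matrix.mul_assoc θᵀ, hθ, Matrix.one_mul, hη]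

theorem one_mem_orthogonalFinset : (1 : Matrix (Fin d) (Fin d) F) ∈ orthogonalFinset F d := by
  simp [mem_orthogonalFinset]

theorem mulVec_dotProduct_mulVec_of_mem_orthogonalFinset {θ : Matrix (Fin d) (Fin d) F}
    (hθ : θ ∈ orthogonalFinset F d) (x y : Fin d → F) :
    (θ *ᵥ x) ⬝ᵥ (θ *ᵥ y) = x ⬝ᵥ y := by
  rw [mem_orthogonalFinset] at hθ
  rw [dotProduct_mulVec, ← mulVec_transpose, mulVec_mulVec, hθ, one_mulVec]

end

/-- The reflection in the hyperplane orthogonal to `a`. It is the identity (because `2 / 0 = 0`)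
when `a` is isotropic. -/
def reflectionMatrix (a : Fin d → F) : Matrix (Fin d) (Fin d) F :=
  1 - (2 / (a ⬝ᵥ a)) • vecMulVec a a

theorem reflectionMatrix_mulVec (a x : Fin d → F) :
    reflectionMatrix a *ᵥ x = x - (2 / (a ⬝ᵥ a) * (a ⬝ᵥ x)) • a := by
  rw [reflectionMatrix, sub_mulVec, one_mulVec, smul_mulVec, vecMulVec_mulVec, mul_smul]
  simp

theorem reflectionMatrix_mul_self {a : Fin d → F} (ha : a ⬝ᵥ a ≠ 0) :
    reflectionMatrix a * reflectionMatrix a = 1 := by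
  have h : vecMulVec a a * vecMulVec a a = (a ⬝ᵥ a) • vecMulVec a a := by
    rw [vecMulVec_mul_vecMulVec]
    ext i j; simp [vecMulVec_apply]; ring
  simp only [reflectionMatrix, sub_mul, mul_sub, Matrix.smul_mul, Matrix.mul_smul, h, smul_smul,
    mul_one, one_mul]
  have : (2 / (a ⬝ᵥ a)) * ((2 / (a ⬝ᵥ a)) * (a ⬝ᵥ a)) = 2 / (a ⬝ᵥ a) + 2 / (a ⬝ᵥ a) := by
    field_simp; ring
  rw [this, add_smul]
  abel

/-- The image of `m` under a reflection moving it determines the direction of the normal of the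
mirror. -/
theorem eq_smul_of_reflectionMatrix_mulVec_eq (h2 : (2 : F) ≠ 0) {a b m : Fin d → F}
    (ha : a ⬝ᵥ a ≠ 0) (ham : a ⬝ᵥ m ≠ 0) (hbm : b ⬝ᵥ m ≠ 0)
    (h : reflectionMatrix a *ᵥ m = reflectionMatrix b *ᵥ m) :
    a = ((a ⬝ᵥ m) / (b ⬝ᵥ m)) • b := by
  rw [reflectionMatrix_mulVec, reflectionMatrix_mulVec, sub_right_inj] at h
  have hα : 2 / (a ⬝ᵥ a) * (a ⬝ᵥ m) ≠ 0 := mul_ne_zero (div_ne_zero h2 ha) ham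
  obtain ⟨c, hc⟩ : ∃ c : F, a = c • b :=
    ⟨(2 / (a ⬝ᵥ a) * (a ⬝ᵥ m))⁻¹ * (2 / (b ⬝ᵥ b) * (b ⬝ᵥ m)), by
      rw [mul_smul, ← h, smul_smul, inv_mul_cancel₀ hα, one_smul]⟩
  have : (a ⬝ᵥ m) / (b ⬝ᵥ m) = c := by
    rw [hc, smul_dotProduct, smul_eq_mul, mul_div_assoc, div_self hbm, mul_one]
  rw [this, ← hc]

variable [Fintype F]

theorem reflectionMatrix_mem_orthogonalFinset {a : Fin d → F} (ha : a ⬝ᵥ a ≠ 0) :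
    reflectionMatrix a ∈ orthogonalFinset F d := by
  have : (reflectionMatrix a)ᵀ = reflectionMatrix a := by
    rw [reflectionMatrix, transpose_sub, transpose_smul, transpose_one, transpose_vecMulVec]
  rw [mem_orthogonalFinset, this, reflectionMatrix_mul_self ha]

open scoped Classical in
theorem card_le_two_mul_card_reflecting (h2 : (2 : F) ≠ 0) (hq : 6 ≤ Fintype.card F)
    {m : Fin d → F} (hm : m ≠ 0) :
    Fintype.card F ^ d ≤ 2 * #{a : Fin d → F | a ⬝ᵥ a ≠ 0 ∧ a ⬝ᵥ m ≠ 0} := by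
  obtain ⟨i, hi⟩ : ∃ i, m i ≠ 0 := Function.ne_iff.1 hm
  have hd : 0 < d := i.pos
  have h1 : Fintype.card F * #{a : Fin d → F | a ⬝ᵥ a = 0} ≤ 2 * Fintype.card F ^ d := by
    simpa using (GramNondegenerate.of_fin_zero (F := F) (d := d) Fin.elim0).card_isotropic_mul_le
      h2 hd
  have h3 : Fintype.card F * #{a : Fin d → F | a ⬝ᵥ m = 0} ≤ Fintype.card F ^ d := by
    have := card_mul_card_le_of_lines (U := univ) (Z := {a : Fin d → F | a ⬝ᵥ m = 0})
      (Pi.single i 1) 1 (by simp) ?_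
    · simpa using this
    · intro y _
      refine card_le_one.2 fun s hs t ht => ?_
      simp only [mem_filter, mem_univ, true_and, add_dotProduct, smul_dotProduct,
        single_one_dotProduct, smul_eq_mul] at hs ht
      exact mul_right_cancel₀ hi (add_left_cancel (hs.trans ht.symm))
  have hsplit : Fintype.card F ^ d ≤ #{a : Fin d → F | a ⬝ᵥ a ≠ 0 ∧ a ⬝ᵥ m ≠ 0} +
      (#{a : Fin d → F | a ⬝ᵥ a = 0} + #{a : Fin d → F | a ⬝ᵥ m = 0}) := by
    have : #(univ : Finset (Fin d → F)) = Fintype.card F ^ d := by simp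
    rw [← this]
    refine le_trans (card_le_card fun a _ => ?_) ((card_union_le _ _).trans
      (Nat.add_le_add_left (card_union_le _ _) _))
    simp only [mem_union, mem_filter, mem_univ, true_and]
    tauto
  nlinarith

open scoped Classical in
/-- The fibers of an orbit map `θ ↦ θ *ᵥ m` have at most `2 * #O / q ^ (d - 1)` elements: composing
such a `θ` with the reflections in vectors `a` not orthogonal to `m` gives orthogonal matrices that
determine `θ`, and `a` up to a scalar. -/
theorem card_orthogonal_mapsTo_mul_le (h2 : (2 : F) ≠ 0) (hq : 6 ≤ Fintype.card F)
    {m : Fin d → F} (hm : m ≠ 0) (v : Fin d → F) :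
    #{θ ∈ orthogonalFinset F d | θ *ᵥ m = v} * Fintype.card F ^ d ≤
      2 * (Fintype.card F * #(orthogonalFinset F d)) := by
  set N : Finset (Matrix (Fin d) (Fin d) F) := {θ ∈ orthogonalFinset F d | θ *ᵥ m = v} with hN
  set R : Finset (Fin d → F) := {a | a ⬝ᵥ a ≠ 0 ∧ a ⬝ᵥ m ≠ 0} with hR
  have hmaps : ∀ p ∈ N ×ˢ R, p.1 * reflectionMatrix p.2 ∈ orthogonalFinset F d := by
    rintro ⟨θ, a⟩ hp
    simp only [hN, hR, mem_product, mem_filter, mem_univ, true_and] at hp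
    exact mul_mem_orthogonalFinset hp.1.1 (reflectionMatrix_mem_orthogonalFinset hp.2.1)
  have key := card_le_mul_card_image_of_maps_to hmaps (Fintype.card F) fun η hη => by
    rcases Finset.eq_empty_or_nonempty {p ∈ N ×ˢ R | p.1 * reflectionMatrix p.2 = η} with
      he | ⟨⟨θ₀, b⟩, h₀⟩
    · rw [he]; simp
    · have hscal : ∀ p ∈ N ×ˢ R, p.1 * reflectionMatrix p.2 = η →
          p.1 = η * reflectionMatrix p.2 ∧ η *ᵥ (reflectionMatrix p.2 *ᵥ m) = v := by
        rintro ⟨θ, a⟩ hp h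
        simp only [hN, hR, mem_product, mem_filter, mem_univ, true_and] at hp h
        have h' : θ = η * reflectionMatrix a := by
          rw [← h, Matrix.mul_assoc, reflectionMatrix_mul_self hp.2.1, Matrix.mul_one]
        refine ⟨h', ?_⟩
        rw [mulVec_mulVec, ← h', hp.1.2]
      simp only [mem_filter] at h₀
      have hdir : ∀ p ∈ N ×ˢ R, p.1 * reflectionMatrix p.2 = η →
          p.2 = ((p.2 ⬝ᵥ m) / (b ⬝ᵥ m)) • b := by
        rintro ⟨θ, a⟩ hp h
        have e1 := (hscal _ hp h).2
        have e2 := (hscal _ h₀.1 h₀.2).2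
        have e3 : reflectionMatrix a *ᵥ m = reflectionMatrix b *ᵥ m := by
          have := congrArg (fun x => ηᵀ *ᵥ x) (e1.trans e2.symm)
          simpa only [mulVec_mulVec, ← Matrix.mul_assoc, mem_orthogonalFinset.1 hη,
            Matrix.one_mul] using this
        have hp := (mem_product.1 hp).2
        have hp₀ := (mem_product.1 h₀.1).2
        simp only [hR, mem_filter, mem_univ, true_and] at hp hp₀
        exact eq_smul_of_reflectionMatrix_mulVec_eq h2 hp.1 hp.2 hp₀.2 e3
      rw [← card_univ]
      refine card_le_card_of_injOn (fun p => (p.2 ⬝ᵥ m) / (b ⬝ᵥ m)) (by simp) ?_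
      rintro ⟨θ, a⟩ hp ⟨θ', a'⟩ hp' h
      simp only [coe_filter, Set.mem_ofPred_eq] at hp hp'
      have e1 := hdir _ hp.1 hp.2
      have e2 := hdir _ hp'.1 hp'.2
      simp only at e1 e2 h
      have haa : a = a' := by rw [e1, e2, h]
      subst haa
      have e3 := (hscal _ hp.1 hp.2).1
      have e4 := (hscal _ hp'.1 hp'.2).1
      simp only at e3 e4
      rw [e3, e4]
  rw [card_product] at key
  calc #N * Fintype.card F ^ d ≤ #N * (2 * #R) := by
        gcongr; exact card_le_two_mul_card_reflecting h2 hq hm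
    _ = 2 * (#N * #R) := by ring
    _ ≤ _ := by gcongr

end

/-! ### Fourier analysis of product sets -/

section

variable {F : Type u} [Field F] {d k : ℕ}

theorem addChar_sum_eq_prod {ι : Type*} (ψ : AddChar F ℂ) (s : Finset ι) (f : ι → F) :
    ψ (∑ i ∈ s, f i) = ∏ i ∈ s, ψ (f i) :=
  map_prod ψ.toMonoidHom (fun i => Multiplicative.ofAdd (f i)) s

theorem charSum_piFinset (ψ : AddChar F ℂ) (A : Fin d → Finset F) (m : Fin d → F) :
    ∑ x ∈ Fintype.piFinset A, ψ (m ⬝ᵥ x) = ∏ i, ∑ a ∈ A i, ψ (m i * a) := by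
  rw [prod_univ_sum]
  refine sum_congr rfl fun x _ => ?_
  rw [dotProduct, addChar_sum_eq_prod]

open scoped Classical in
/-- The number of points of `E` that the rigid motion `x ↦ z + θ *ᵥ x` maps into `E`. -/
noncomputable def congruenceCount (E : Finset (Fin d → F)) (θ : Matrix (Fin d) (Fin d) F)
    (z : Fin d → F) : ℕ := #{x ∈ E | z + θ *ᵥ x ∈ E}

open scoped Classical in
theorem congruenceCount_eq_card (E : Finset (Fin d → F)) (θ : Matrix (Fin d) (Fin d) F)
    (z : Fin d → F) :
    congruenceCount E θ z = #{p ∈ E ×ˢ E | p.2 - θ *ᵥ p.1 = z} := by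
  rw [congruenceCount]
  refine card_nbij' (fun x => (x, z + θ *ᵥ x)) Prod.fst ?_ ?_ ?_ ?_
  · intro x hx
    simpa using hx
  · rintro ⟨x, y⟩ hp
    simp only [coe_filter, mem_product, Set.mem_ofPred_eq] at hp ⊢
    rw [← hp.2, sub_add_cancel]
    exact hp.1
  · intro x _
    rfl
  · rintro ⟨x, y⟩ hp
    simp only [coe_filter, mem_product, Set.mem_ofPred_eq] at hp ⊢
    rw [← hp.2, sub_add_cancel]

open scoped Classical in
theorem congruenceCount_le_card (E : Finset (Fin d → F)) (θ : Matrix (Fin d) (Fin d) F)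
    (z : Fin d → F) : congruenceCount E θ z ≤ #E := card_filter_le _ _

variable [Fintype F]

open scoped Classical in
theorem sum_addChar_dotProduct {ι : Type*} [Fintype ι] [DecidableEq ι]
    {ψ : AddChar F ℂ} (hψ : ψ.IsPrimitive)
    (x : ι → F) :
    ∑ m : ι → F, ψ (m ⬝ᵥ x) =
      if x = 0 then (Fintype.card F : ℂ) ^ Fintype.card ι else 0 := by
  have h : ∀ m : ι → F, ψ (m ⬝ᵥ x) = ∏ i, ψ (m i * x i) := fun m => by
    rw [dotProduct, addChar_sum_eq_prod]
  simp_rw [h]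
  rw [← Fintype.piFinset_univ, ← prod_univ_sum (fun _ => univ) fun i t => ψ (t * x i)]
  simp_rw [AddChar.sum_mulShift _ hψ]
  split_ifs with hx
  · simp [hx]
  · obtain ⟨i, hi⟩ := Function.ne_iff.1 hx
    exact prod_eq_zero (mem_univ i) (by simpa using hi)

open scoped Classical in
/-- Plancherel's identity for the multiplicity function of `g` on `s`. -/
theorem sum_norm_sq_charSum {ι α : Type*} [Fintype ι] [DecidableEq ι]
    {ψ : AddChar F ℂ} (hψ : ψ.IsPrimitive)
    (s : Finset α) (g : α → ι → F) :
    ∑ m : ι → F, ‖∑ a ∈ s, ψ (m ⬝ᵥ g a)‖ ^ 2 =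
      (Fintype.card F : ℝ) ^ Fintype.card ι * ∑ z, (#{a ∈ s | g a = z} : ℝ) ^ 2 := by
  have h1 : ∀ m : ι → F, ((‖∑ a ∈ s, ψ (m ⬝ᵥ g a)‖ ^ 2 : ℝ) : ℂ) =
      ∑ a ∈ s, ∑ b ∈ s, ψ (m ⬝ᵥ (g a - g b)) := fun m => by
    push_cast
    rw [← Complex.mul_conj', map_sum, sum_mul_sum]
    refine sum_congr rfl fun a _ => sum_congr rfl fun b _ => ?_
    rw [← AddChar.map_neg_eq_conj, ← AddChar.map_add_eq_mul, dotProduct_sub, sub_eq_add_neg]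
  have h2 : ∀ a ∈ s, ∑ b ∈ s, (if g a = g b then 1 else 0 : ℂ) =
      ∑ z, if g a = z then (#{b ∈ s | g b = z} : ℂ) else 0 := fun a _ => by
    rw [sum_ite_eq univ (g a) fun z => (#{b ∈ s | g b = z} : ℂ), if_pos (mem_univ _),
      sum_boole]
    simp_rw [eq_comm]
  apply Complex.ofReal_injective
  rw [Complex.ofReal_sum]
  simp_rw [h1]
  rw [sum_comm]
  simp_rw [sum_comm (s := univ) (t := s), sum_addChar_dotProduct hψ, sub_eq_zero]
  push_cast
  rw [mul_sum]
  simp_rw [← mul_boole _ ((Fintype.card F : ℂ) ^ Fintype.card ι)]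
  simp_rw [← mul_sum]
  rw [sum_congr rfl h2, sum_comm]
  congr 1
  refine sum_congr rfl fun z _ => ?_
  rw [← sum_filter, sum_const, nsmul_eq_mul, sq]

theorem sum_congruenceCount (E : Finset (Fin d → F)) (θ : Matrix (Fin d) (Fin d) F) :
    ∑ z, congruenceCount E θ z = #E ^ 2 := by
  classical
  simp_rw [congruenceCount_eq_card]
  rw [← card_eq_sum_card_fiberwise (by simp), card_product, sq]

/-- The Fourier transform of `congruenceCount E θ` at `m` is the product of the transform of `E` at
`m` and the conjugate of the one at `θᵀ *ᵥ m`. -/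
theorem sum_congruenceCount_sq {ψ : AddChar F ℂ} (hψ : ψ.IsPrimitive) (E : Finset (Fin d → F))
    (θ : Matrix (Fin d) (Fin d) F) :
    (Fintype.card F : ℝ) ^ d * ∑ z, (congruenceCount E θ z : ℝ) ^ 2 =
      ∑ m : Fin d → F, ‖∑ x ∈ E, ψ (m ⬝ᵥ x)‖ ^ 2 * ‖∑ x ∈ E, ψ ((θᵀ *ᵥ m) ⬝ᵥ x)‖ ^ 2 := by
  classical
  simp_rw [congruenceCount_eq_card]
  have := sum_norm_sq_charSum hψ (E ×ˢ E) fun p => p.2 - θ *ᵥ p.1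
  rw [Fintype.card_fin] at this
  rw [← this]
  refine sum_congr rfl fun m _ => ?_
  rw [← mul_pow, ← Complex.norm_conj (∑ x ∈ E, ψ ((θᵀ *ᵥ m) ⬝ᵥ x)), ← norm_mul, mul_comm,
    map_sum, sum_mul_sum, sum_product]
  congr 2
  refine sum_congr rfl fun x _ => sum_congr rfl fun y _ => ?_
  rw [← AddChar.map_neg_eq_conj, ← AddChar.map_add_eq_mul, dotProduct_sub, dotProduct_mulVec,
    mulVec_transpose, neg_add_eq_sub]

open scoped Classical in
/-- An average over an orbit of the orthogonal group is at most twice the sum over the sphere that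
contains the orbit, divided by `q ^ (d - 1)`. -/
theorem sum_orthogonal_apply_le (h2 : (2 : F) ≠ 0) (hq : 6 ≤ Fintype.card F)
    {h : (Fin d → F) → ℝ} (hh : ∀ v, 0 ≤ h v) {m : Fin d → F} (hm : m ≠ 0) :
    (Fintype.card F : ℝ) ^ d * ∑ θ ∈ orthogonalFinset F d, h (θᵀ *ᵥ m) ≤
      2 * (Fintype.card F * #(orthogonalFinset F d)) * ∑ v with v ⬝ᵥ v = m ⬝ᵥ m, h v := by
  have e1 : ∑ θ ∈ orthogonalFinset F d, h (θᵀ *ᵥ m) =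
      ∑ θ ∈ orthogonalFinset F d, h (θ *ᵥ m) :=
    sum_nbij' transpose transpose (fun _ => transpose_mem_orthogonalFinset)
      (fun _ => transpose_mem_orthogonalFinset) (by simp) (by simp) (by simp)
  have e2 : ∑ θ ∈ orthogonalFinset F d, h (θ *ᵥ m) =
      ∑ v with v ⬝ᵥ v = m ⬝ᵥ m, #{θ ∈ orthogonalFinset F d | θ *ᵥ m = v} * h v := by
    rw [← sum_fiberwise_of_maps_to (t := {v : Fin d → F | v ⬝ᵥ v = m ⬝ᵥ m})
      (g := fun θ : Matrix (Fin d) (Fin d) F => θ *ᵥ m)]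
    · refine sum_congr rfl fun v _ => ?_
      rw [← nsmul_eq_mul, ← sum_const]
      refine sum_congr rfl fun θ hθ => ?_
      rw [(mem_filter.1 hθ).2]
    · intro θ hθ
      simpa using mulVec_dotProduct_mulVec_of_mem_orthogonalFinset hθ m m
  rw [e1, e2, mul_sum, mul_sum]
  refine sum_le_sum fun v _ => ?_
  rw [← mul_assoc]
  refine mul_le_mul_of_nonneg_right ?_ (hh v)
  rw [mul_comm]
  exact_mod_cast card_orthogonal_mapsTo_mul_le h2 hq hm v

open scoped Classical in
/-- A sum of a product function over a sphere: if all coordinates but the `i`-th are fixed, then at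
most two values of the `i`-th one are left. -/
theorem sum_prod_sphere_le {n : ℕ} (i : Fin (n + 1)) {h : Fin (n + 1) → F → ℝ}
    (hh : ∀ j t, 0 ≤ h j t) {B : ℝ} (hB : ∀ t, h i t ≤ B) (c : F) :
    ∑ v : Fin (n + 1) → F with v ⬝ᵥ v = c, ∏ j, h j (v j) ≤
      2 * B * ∏ j, ∑ t, h (i.succAbove j) t := by
  have hB0 : 0 ≤ B := (hh i 0).trans (hB 0)
  rw [sum_filter, ← (Fin.insertNthEquiv (fun _ => F) i).sum_comp, Fintype.sum_prod_type, sum_comm,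
    prod_univ_sum, Fintype.piFinset_univ, mul_sum]
  refine sum_le_sum fun w _ => ?_
  have hP : 0 ≤ ∏ j, h (i.succAbove j) (w j) := prod_nonneg fun j _ => hh _ _
  rw [← sum_filter]
  have hcard : #{t : F | (Fin.insertNthEquiv (fun _ => F) i) (t, w) ⬝ᵥ
      (Fin.insertNthEquiv (fun _ => F) i) (t, w) = c} ≤ 2 := by
    refine le_trans (card_le_card fun t ht => ?_)
      (card_quadratic_roots_le_two one_ne_zero 0 (w ⬝ᵥ w - c))
    simp only [mem_filter, mem_univ, true_and] at ht ⊢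
    rw [← ht]
    simp [dotProduct, Fin.sum_univ_succAbove _ i]
    ring
  calc _ ≤ ∑ t : F with (Fin.insertNthEquiv (fun _ => F) i) (t, w) ⬝ᵥ
      (Fin.insertNthEquiv (fun _ => F) i) (t, w) = c, B * ∏ j, h (i.succAbove j) (w j) := by
        refine sum_le_sum fun t _ => ?_
        rw [Fin.prod_univ_succAbove _ i]
        simp only [Fin.insertNthEquiv_apply, Fin.insertNth_apply_same,
          Fin.insertNth_apply_succAbove]
        gcongr
        exact hB t
    _ ≤ _ := by
        rw [sum_const, nsmul_eq_mul, mul_assoc]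
        gcongr
        exact_mod_cast hcard

theorem norm_charSum_field_le (ψ : AddChar F ℂ) (A : Finset F) (t : F) :
    ‖∑ a ∈ A, ψ (t * a)‖ ^ 2 ≤ (#A : ℝ) ^ 2 := by
  gcongr
  refine (norm_sum_le _ _).trans ?_
  simp [AddChar.norm_apply]

theorem sum_norm_sq_charSum_field {ψ : AddChar F ℂ} (hψ : ψ.IsPrimitive) (A : Finset F) :
    ∑ t : F, ‖∑ a ∈ A, ψ (t * a)‖ ^ 2 = Fintype.card F * #A := by
  classical
  have := sum_norm_sq_charSum hψ A fun a (_ : Unit) => a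
  rw [← (Equiv.funUnique Unit F).symm.sum_comp, ← (Equiv.funUnique Unit F).symm.sum_comp] at this
  simp only [dotProduct, Equiv.funUnique_symm_apply, uniqueElim_const, univ_unique, sum_const,
    card_singleton, one_smul, Fintype.card_unit, pow_one, funext_iff, forall_const] at this
  rw [this]
  congr 1
  have h : ∀ z, ((#{a ∈ A | a = z} : ℝ)) ^ 2 = if z ∈ A then 1 else 0 := fun z => by
    split_ifs with hz
    · rw [card_eq_one.2 ⟨z, by ext a; simp only [mem_filter, mem_singleton]; aesop⟩]
      norm_num
    · rw [card_eq_zero.2 (by ext a; simp only [mem_filter, notMem_empty]; aesop)]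
      norm_num
  simp_rw [h]
  simp

theorem exists_isPrimitive_addChar (F : Type u) [Field F] [Fintype F] :
    ∃ ψ : AddChar F ℂ, ψ.IsPrimitive :=
  ⟨_, AddChar.FiniteField.primitiveChar_to_Complex_isPrimitive F⟩

/-- Second moment bound. Up to the frequency `m = 0`, which gives the first term, the sum is at most
a sum over pairs of frequencies of equal norm. This is where the product structure of the set
enters. -/
theorem sum_sum_congruenceCount_sq_le (h2 : (2 : F) ≠ 0) (hq : 6 ≤ Fintype.card F)
    (A : Fin d → Finset F) (i : Fin d) :
    ∑ θ ∈ orthogonalFinset F d, ∑ z, (congruenceCount (Fintype.piFinset A) θ z : ℝ) ^ 2 ≤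
      #(orthogonalFinset F d) *
        ((#(Fintype.piFinset A) : ℝ) ^ 4 / (Fintype.card F : ℝ) ^ d +
          4 * (#(Fintype.piFinset A) : ℝ) ^ 2 * #(A i)) := by
  classical
  obtain ⟨n, rfl⟩ : ∃ n, d = n + 1 := ⟨d - 1, by have := i.pos; omega⟩
  obtain ⟨ψ, hψ⟩ := exists_isPrimitive_addChar F
  set q : ℝ := (Fintype.card F : ℝ) with hqd
  have hq0 : 0 < q := by rw [hqd]; exact_mod_cast Fintype.card_pos
  set E := Fintype.piFinset A with hE
  set O := orthogonalFinset F (n + 1)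
  set h : (Fin (n + 1) → F) → ℝ := fun m => ‖∑ x ∈ E, ψ (m ⬝ᵥ x)‖ ^ 2 with hh
  set P : ℝ := ∏ j, (#(A (i.succAbove j)) : ℝ) with hP
  have hEP : (#E : ℝ) = #(A i) * P := by
    rw [hE, Fintype.card_piFinset, Fin.prod_univ_succAbove _ i]
    push_cast
    rfl
  have hprod : ∀ m, h m = ∏ j, ‖∑ a ∈ A j, ψ (m j * a)‖ ^ 2 := fun m => by
    simp only [hh, hE, charSum_piFinset, norm_prod, prod_pow]
  have hh0 : ∀ m, 0 ≤ h m := fun m => sq_nonneg _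
  have hsum : ∑ m, h m = q ^ (n + 1) * #E := by
    rw [sum_congr rfl fun m _ => hprod m, ← Fintype.piFinset_univ,
      ← prod_univ_sum (fun _ => univ) fun j t => ‖∑ a ∈ A j, ψ (t * a)‖ ^ 2]
    simp_rw [sum_norm_sq_charSum_field hψ]
    rw [prod_mul_distrib, hE, Fintype.card_piFinset]
    simp [q]
  have hsphere : ∀ c, ∑ v with v ⬝ᵥ v = c, h v ≤ 2 * (#(A i) : ℝ) ^ 2 * (q ^ n * P) := fun c => by
    rw [sum_congr rfl fun m _ => hprod m]
    refine (sum_prod_sphere_le i (h := fun j t => ‖∑ a ∈ A j, ψ (t * a)‖ ^ 2)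
      (fun _ _ => sq_nonneg _) (norm_charSum_field_le ψ (A i)) c).trans (le_of_eq ?_)
    simp_rw [sum_norm_sq_charSum_field hψ]
    rw [prod_mul_distrib]
    simp [q, hP]
  have hzero : h 0 = (#E : ℝ) ^ 2 := by simp [hh]
  have hexp : q ^ (n + 1) * ∑ θ ∈ O, ∑ z, (congruenceCount E θ z : ℝ) ^ 2 =
      ∑ m, h m * ∑ θ ∈ O, h (θᵀ *ᵥ m) := by
    rw [mul_sum]
    rw [sum_congr rfl fun θ _ => sum_congruenceCount_sq hψ E θ, sum_comm]
    exact sum_congr rfl fun m _ => (mul_sum _ _ _).symm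
  have hP0 : 0 ≤ P := prod_nonneg fun _ _ => Nat.cast_nonneg _
  have horb : ∀ m, m ≠ 0 → q ^ (n + 1) * ∑ θ ∈ O, h (θᵀ *ᵥ m) ≤
      2 * (q * #O) * ∑ v with v ⬝ᵥ v = m ⬝ᵥ m, h v := fun m hm =>
    sum_orthogonal_apply_le h2 hq hh0 hm
  clear_value h P O E
  have hterm : ∀ m, q ^ (n + 1) * (h m * ∑ θ ∈ O, h (θᵀ *ᵥ m)) ≤
      (if m = 0 then q ^ (n + 1) * (#O * (#E : ℝ) ^ 4) else 0) +
        h m * (2 * (q * #O) * (2 * (#(A i) : ℝ) ^ 2 * (q ^ n * P))) := fun m => by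
    have hpos : 0 ≤ h m * (2 * (q * #O) * (2 * (#(A i) : ℝ) ^ 2 * (q ^ n * P))) := by
      refine mul_nonneg (hh0 m) ?_
      positivity
    by_cases hm : m = 0
    · rw [if_pos hm]
      subst hm
      refine le_add_of_le_of_nonneg (le_of_eq ?_) hpos
      have hconst : ∑ θ ∈ O, h (θᵀ *ᵥ 0) = #O * (#E : ℝ) ^ 2 := by
        rw [sum_congr rfl fun θ _ => (congrArg h (mulVec_zero θᵀ)).trans hzero, sum_const,
          nsmul_eq_mul]
      rw [hconst, hzero]
      ring
    · rw [if_neg hm, zero_add]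
      calc q ^ (n + 1) * (h m * ∑ θ ∈ O, h (θᵀ *ᵥ m))
          = h m * (q ^ (n + 1) * ∑ θ ∈ O, h (θᵀ *ᵥ m)) := by ring
        _ ≤ h m * (2 * (q * #O) * ∑ v with v ⬝ᵥ v = m ⬝ᵥ m, h v) :=
          mul_le_mul_of_nonneg_left (horb m hm) (hh0 m)
        _ ≤ _ := by
          refine mul_le_mul_of_nonneg_left ?_ (hh0 m)
          gcongr
          exact hsphere _
  have hkey : q ^ (n + 1) * (q ^ (n + 1) * ∑ θ ∈ O, ∑ z, (congruenceCount E θ z : ℝ) ^ 2) ≤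
      q ^ (n + 1) * (q ^ (n + 1) *
        (#O * ((#E : ℝ) ^ 4 / q ^ (n + 1) + 4 * (#E : ℝ) ^ 2 * #(A i)))) := by
    rw [hexp, mul_sum]
    refine (sum_le_sum fun m _ => hterm m).trans (le_of_eq ?_)
    rw [sum_add_distrib, ← sum_mul, hsum, sum_ite_eq' univ, if_pos (mem_univ _), hEP]
    field_simp
    ring
  have hqp : 0 < q ^ (n + 1) := by positivity
  exact le_of_mul_le_mul_left (le_of_mul_le_mul_left hkey hqp) hqp

end

/-! ### Moments and congruent simplices -/

section

/-- Taylor's formula at `b` with a quadratic remainder. -/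
theorem pow_add_two_le_taylor {a b M : ℝ} (ha : 0 ≤ a) (hb : 0 ≤ b) (haM : a ≤ M) (hbM : b ≤ M)
    (j : ℕ) :
    a ^ (j + 2) ≤ b ^ (j + 2) + (j + 2) * b ^ (j + 1) * (a - b) +
      (j + 1) ^ 2 * M ^ j * (a - b) ^ 2 := by
  induction j with
  | zero => push_cast; nlinarith
  | succ j ih =>
    have hM : 0 ≤ M := ha.trans haM
    have h1 : b ^ (j + 1) ≤ M ^ (j + 1) := by gcongr
    have h2 : a * M ^ j ≤ M ^ (j + 1) := by rw [pow_succ']; gcongr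
    have h3 : 0 ≤ (a - b) ^ 2 := sq_nonneg _
    have h4 : 0 ≤ M ^ (j + 1) := by positivity
    push_cast
    calc a ^ (j + 1 + 2) = a * a ^ (j + 2) := by ring
      _ ≤ a * (b ^ (j + 2) + (j + 2) * b ^ (j + 1) * (a - b) +
          (j + 1) ^ 2 * M ^ j * (a - b) ^ 2) := by gcongr
      _ = b ^ (j + 1 + 2) + (j + 1 + 2) * b ^ (j + 1 + 1) * (a - b) +
          ((j + 2) * b ^ (j + 1) + (j + 1) ^ 2 * (a * M ^ j)) * (a - b) ^ 2 := by ring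
      _ ≤ b ^ (j + 1 + 2) + (j + 1 + 2) * b ^ (j + 1 + 1) * (a - b) +
          ((j + 2) * M ^ (j + 1) + (j + 1) ^ 2 * M ^ (j + 1)) * (a - b) ^ 2 := by gcongr
      _ ≤ _ := by
          have : ((j : ℝ) + 2) * M ^ (j + 1) + (j + 1) ^ 2 * M ^ (j + 1) ≤
              ((j : ℝ) + 1 + 1) ^ 2 * M ^ (j + 1) := by
            have : (0 : ℝ) ≤ j := Nat.cast_nonneg j
            rw [← add_mul]
            gcongr
            nlinarith
          gcongr

/-- A bounded function with mean `μ` has a `j + 2`-th moment close to that of a constant, with an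
error controlled by its variance. -/
theorem sum_pow_add_two_le {Z : Type*} [Fintype Z] (f : Z → ℝ) {M μ : ℝ} (hf : ∀ z, 0 ≤ f z)
    (hfM : ∀ z, f z ≤ M) (hμ : 0 ≤ μ) (hμM : μ ≤ M) (hsum : ∑ z, f z = Fintype.card Z * μ)
    (j : ℕ) :
    ∑ z, f z ^ (j + 2) ≤ Fintype.card Z * μ ^ (j + 2) +
      (j + 1) ^ 2 * M ^ j * (∑ z, f z ^ 2 - Fintype.card Z * μ ^ 2) := by
  have hvar : ∑ z, (f z - μ) ^ 2 = ∑ z, f z ^ 2 - Fintype.card Z * μ ^ 2 := by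
    have : ∀ z, (f z - μ) ^ 2 = f z ^ 2 - 2 * μ * f z + μ ^ 2 := fun z => by ring
    simp_rw [this]
    rw [sum_add_distrib, sum_sub_distrib, ← mul_sum, hsum, sum_const, card_univ, nsmul_eq_mul]
    ring
  have hlin : ∑ z, (f z - μ) = 0 := by
    rw [sum_sub_distrib, hsum, sum_const, card_univ, nsmul_eq_mul, sub_self]
  refine (sum_le_sum fun z _ => pow_add_two_le_taylor (hf z) hμ (hfM z) hμM j).trans
    (le_of_eq ?_)
  rw [sum_add_distrib, sum_add_distrib, ← mul_sum, ← mul_sum, hlin, hvar, sum_const, card_univ,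
    nsmul_eq_mul, mul_zero, add_zero]

open scoped Classical in
theorem card_forall_apply_mem {X : Type*} [Fintype X] (S : Finset X) (n : ℕ) :
    #{w : Fin n → X | ∀ i, w i ∈ S} = #S ^ n := by
  have : ({w : Fin n → X | ∀ i, w i ∈ S} : Finset _) = Fintype.piFinset fun _ => S := by
    ext w; simp
  rw [this, Fintype.card_piFinset_const]

variable {F : Type u} [Field F] [Fintype F] {d k : ℕ}

theorem sum_sum_congruenceCount_pow_le (h2 : (2 : F) ≠ 0) (hq : 6 ≤ Fintype.card F)
    (A : Fin d → Finset F) (i : Fin d) (hk : 1 ≤ k) :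
    ∑ θ ∈ orthogonalFinset F d,
        ∑ z, (congruenceCount (Fintype.piFinset A) θ z : ℝ) ^ (k + 1) ≤
      #(orthogonalFinset F d) *
        ((#(Fintype.piFinset A) : ℝ) ^ (2 * (k + 1)) / (Fintype.card F : ℝ) ^ (d * k) +
          4 * k ^ 2 * (#(Fintype.piFinset A) : ℝ) ^ (k + 1) * #(A i)) := by
  obtain ⟨j, rfl⟩ : ∃ j, k = j + 1 := ⟨k - 1, by omega⟩
  have hmain := sum_sum_congruenceCount_sq_le h2 hq A i
  set E := Fintype.piFinset A
  set O := orthogonalFinset F d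
  set q : ℝ := (Fintype.card F : ℝ) with hqd
  have hq0 : 0 < q := by rw [hqd]; exact_mod_cast Fintype.card_pos
  have hcard : (Fintype.card (Fin d → F) : ℝ) = q ^ d := by simp [q]
  have hEq : (#E : ℝ) ≤ q ^ d := by rw [← hcard]; exact_mod_cast card_le_univ E
  have hqd0 : 0 < q ^ d := by positivity
  set μ : ℝ := (#E : ℝ) ^ 2 / q ^ d with hμ
  have hμM : μ ≤ #E := by
    rw [hμ, div_le_iff₀ hqd0, sq]
    gcongr
  have hpt : ∀ θ, ∑ z, (congruenceCount E θ z : ℝ) ^ (j + 2) ≤ q ^ d * μ ^ (j + 2) +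
      (j + 1) ^ 2 * (#E : ℝ) ^ j * (∑ z, (congruenceCount E θ z : ℝ) ^ 2 - q ^ d * μ ^ 2) :=
    fun θ => by
    rw [← hcard]
    refine sum_pow_add_two_le _ (fun _ => Nat.cast_nonneg _)
      (fun z => by exact_mod_cast congruenceCount_le_card E θ z) (by positivity) hμM ?_ j
    rw [hcard, hμ, mul_div_cancel₀ _ hqd0.ne']
    exact_mod_cast sum_congruenceCount E θ
  have hvar : ∑ θ ∈ O, (∑ z, (congruenceCount E θ z : ℝ) ^ 2 - q ^ d * μ ^ 2) ≤
      #O * (4 * (#E : ℝ) ^ 2 * #(A i)) := by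
    rw [sum_sub_distrib, sum_const, nsmul_eq_mul, sub_le_iff_le_add, ← mul_add]
    refine hmain.trans (le_of_eq ?_)
    have : q ^ d * μ ^ 2 = (#E : ℝ) ^ 4 / q ^ d := by rw [hμ]; field_simp
    rw [this, add_comm]
  calc _ ≤ ∑ θ ∈ O, (q ^ d * μ ^ (j + 2) + (j + 1) ^ 2 * (#E : ℝ) ^ j *
          (∑ z, (congruenceCount E θ z : ℝ) ^ 2 - q ^ d * μ ^ 2)) :=
        sum_le_sum fun θ _ => hpt θ
    _ = #O * (q ^ d * μ ^ (j + 2)) + (j + 1) ^ 2 * (#E : ℝ) ^ j *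
          ∑ θ ∈ O, (∑ z, (congruenceCount E θ z : ℝ) ^ 2 - q ^ d * μ ^ 2) := by
        rw [sum_add_distrib, sum_const, nsmul_eq_mul, mul_sum]
    _ ≤ #O * (q ^ d * μ ^ (j + 2)) + (j + 1) ^ 2 * (#E : ℝ) ^ j *
          (#O * (4 * (#E : ℝ) ^ 2 * #(A i))) := by gcongr
    _ = _ := by
        have : q ^ d * μ ^ (j + 2) = (#E : ℝ) ^ (2 * (j + 1 + 1)) / q ^ (d * (j + 1)) := by
          rw [hμ, div_pow, ← pow_mul, ← pow_mul, mul_div_assoc', div_eq_div_iff (by positivity)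
            (by positivity)]
          ring
        rw [this]
        push_cast
        ring

open scoped Classical in
/-- The number of rigid motions mapping all vertices of the simplex `w` into `E`. -/
noncomputable def placementCount (E : Finset (Fin d → F)) (w : Fin (k + 1) → Fin d → F) : ℕ :=
  #{g ∈ orthogonalFinset F d ×ˢ (univ : Finset (Fin d → F)) | ∀ i, g.2 + g.1 *ᵥ w i ∈ E}

open scoped Classical in
/-- If two rigid motions both map `u` into `E`, then the quotient motion maps the first image of
`u`, a point of `E`, into `E`. -/
theorem card_common_preimage (E : Finset (Fin d → F)) {θ η : Matrix (Fin d) (Fin d) F}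
    (hθ : θ ∈ orthogonalFinset F d) (z y : Fin d → F) :
    #{u : Fin d → F | z + θ *ᵥ u ∈ E ∧ y + η *ᵥ u ∈ E} =
      congruenceCount E (η * θᵀ) (y - (η * θᵀ) *ᵥ z) := by
  have h1 := mem_orthogonalFinset.1 hθ
  have h2 : θ * θᵀ = 1 := mul_eq_one_comm.1 h1
  have e1 : ∀ x, y - (η * θᵀ) *ᵥ z + (η * θᵀ) *ᵥ x = y + η *ᵥ (θᵀ *ᵥ (x - z)) := fun x => by
    rw [mulVec_mulVec, mulVec_sub]; abel
  have e2 : ∀ u, θᵀ *ᵥ (z + θ *ᵥ u - z) = u := fun u => by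
    rw [add_sub_cancel_left, mulVec_mulVec, h1, one_mulVec]
  have e3 : ∀ x, z + θ *ᵥ (θᵀ *ᵥ (x - z)) = x := fun x => by
    rw [mulVec_mulVec, h2, one_mulVec, add_sub_cancel]
  rw [congruenceCount]
  refine card_nbij' (fun u => z + θ *ᵥ u) (fun x => θᵀ *ᵥ (x - z)) ?_ ?_ ?_ ?_
  · intro u hu
    simpa only [coe_filter, Set.mem_ofPred_eq, mem_univ, true_and, e1, e2] using hu
  · intro x hx
    simpa only [coe_filter, Set.mem_ofPred_eq, mem_univ, true_and, e1, e3] using hx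
  · intro u _
    exact e2 u
  · intro x _
    exact e3 x

theorem sum_placementCount (E : Finset (Fin d → F)) (k : ℕ) :
    ∑ w : Fin (k + 1) → Fin d → F, placementCount E w =
      #(orthogonalFinset F d) * Fintype.card F ^ d * #E ^ (k + 1) := by
  classical
  simp_rw [placementCount, card_filter]
  rw [sum_comm]
  have h : ∀ g ∈ orthogonalFinset F d ×ˢ (univ : Finset (Fin d → F)),
      ∑ w : Fin (k + 1) → Fin d → F, (if ∀ i, g.2 + g.1 *ᵥ w i ∈ E then 1 else 0) =
        #E ^ (k + 1) := by
    rintro ⟨θ, z⟩ hg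
    have hθ := (mem_product.1 hg).1
    have hS : #{u : Fin d → F | z + θ *ᵥ u ∈ E} = #E := by
      have := card_common_preimage E (η := θ) hθ z z
      simp only [and_self] at this
      rw [this, mul_eq_one_comm.1 (mem_orthogonalFinset.1 hθ)]
      simp [congruenceCount]
    rw [← card_filter, ← hS, ← card_forall_apply_mem]
    simp
  rw [sum_congr rfl h]
  simp

theorem sum_placementCount_sq (E : Finset (Fin d → F)) (k : ℕ) :
    ∑ w : Fin (k + 1) → Fin d → F, placementCount E w ^ 2 =
      #(orthogonalFinset F d) * Fintype.card F ^ d *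
        ∑ θ ∈ orthogonalFinset F d, ∑ z, congruenceCount E θ z ^ (k + 1) := by
  classical
  set G := orthogonalFinset F d ×ˢ (univ : Finset (Fin d → F))
  have h1 : ∀ w : Fin (k + 1) → Fin d → F, placementCount E w ^ 2 =
      ∑ g ∈ G, ∑ g' ∈ G, if ∀ i, g.2 + g.1 *ᵥ w i ∈ E ∧ g'.2 + g'.1 *ᵥ w i ∈ E then 1 else 0 := by
    intro w
    simp_rw [placementCount, card_filter, sq, sum_mul_sum, forall_and, ite_and, mul_ite, mul_one,
      mul_zero]
    refine sum_congr rfl fun g _ => sum_congr rfl fun g' _ => ?_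
    split_ifs <;> rfl
  have h2 : ∀ g ∈ G, ∀ g' : Matrix (Fin d) (Fin d) F × (Fin d → F),
      ∑ w : Fin (k + 1) → Fin d → F,
        (if ∀ i, g.2 + g.1 *ᵥ w i ∈ E ∧ g'.2 + g'.1 *ᵥ w i ∈ E then 1 else 0) =
      congruenceCount E (g'.1 * g.1ᵀ) (g'.2 - (g'.1 * g.1ᵀ) *ᵥ g.2) ^ (k + 1) := by
    intro g hg g'
    rw [← card_common_preimage E (mem_product.1 hg).1, ← card_forall_apply_mem, card_filter]
    simp
  have h3 : ∀ g ∈ G, ∑ g' ∈ G,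
      congruenceCount E (g'.1 * g.1ᵀ) (g'.2 - (g'.1 * g.1ᵀ) *ᵥ g.2) ^ (k + 1) =
      ∑ θ ∈ orthogonalFinset F d, ∑ z, congruenceCount E θ z ^ (k + 1) := by
    rintro ⟨θ, z⟩ hg
    have hθ := (mem_product.1 hg).1
    have hθ1 := mem_orthogonalFinset.1 hθ
    rw [sum_product]
    have hshift : ∀ η : Matrix (Fin d) (Fin d) F,
        ∑ y, congruenceCount E (η * θᵀ) (y - (η * θᵀ) *ᵥ z) ^ (k + 1) =
          ∑ y, congruenceCount E (η * θᵀ) y ^ (k + 1) := fun η =>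
      (Equiv.subRight ((η * θᵀ) *ᵥ z)).sum_comp fun y => congruenceCount E (η * θᵀ) y ^ (k + 1)
    simp_rw [hshift]
    refine sum_nbij' (fun η => η * θᵀ) (fun η => η * θ)
      (fun η hη => mul_mem_orthogonalFinset hη (transpose_mem_orthogonalFinset hθ))
      (fun η hη => mul_mem_orthogonalFinset hη hθ) ?_ ?_ (fun _ _ => rfl)
    · intro η _
      rw [Matrix.mul_assoc, hθ1, Matrix.mul_one]
    · intro η _
      rw [Matrix.mul_assoc, mul_eq_one_comm.1 hθ1, Matrix.mul_one]
  calc _ = ∑ g ∈ G, ∑ g' ∈ G, ∑ w : Fin (k + 1) → Fin d → F,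
        (if ∀ i, g.2 + g.1 *ᵥ w i ∈ E ∧ g'.2 + g'.1 *ᵥ w i ∈ E then 1 else 0) := by
        simp_rw [h1]
        rw [sum_comm]
        exact sum_congr rfl fun g _ => sum_comm
    _ = ∑ g ∈ G, ∑ θ ∈ orthogonalFinset F d, ∑ z, congruenceCount E θ z ^ (k + 1) :=
        sum_congr rfl fun g hg => by
          rw [sum_congr rfl fun g' _ => h2 g hg g', h3 g hg]
    _ = _ := by simp [G]

open scoped Classical in
/-- The simplices of the whole space that are congruent to a simplex with vertices in `E`. -/
noncomputable def congruentSimplices (k : ℕ) (E : Finset (Fin d → F)) :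
    Finset (Fin (k + 1) → Fin d → F) :=
  {w | ∃ θ ∈ orthogonalFinset F d, ∃ z : Fin d → F, ∀ i, z + θ *ᵥ w i ∈ E}

theorem placementCount_eq_zero {E : Finset (Fin d → F)} {w : Fin (k + 1) → Fin d → F}
    (hw : w ∉ congruentSimplices k E) : placementCount E w = 0 := by
  classical
  rw [placementCount, card_eq_zero, filter_eq_empty_iff]
  rintro ⟨θ, z⟩ hg h
  refine hw ?_
  simp only [congruentSimplices, mem_filter, mem_univ, true_and]
  exact ⟨θ, (mem_product.1 hg).1, z, h⟩

/-- Cauchy–Schwarz for `placementCount`, which is supported on `congruentSimplices k E`. -/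
theorem card_mul_pow_le_card_congruentSimplices (E : Finset (Fin d → F)) (k : ℕ) :
    #(orthogonalFinset F d) * Fintype.card F ^ d * #E ^ (2 * (k + 1)) ≤
      #(congruentSimplices k E) *
        ∑ θ ∈ orthogonalFinset F d, ∑ z, congruenceCount E θ z ^ (k + 1) := by
  have hsub : ∀ n : ℕ, n ≠ 0 → ∑ w ∈ congruentSimplices k E, placementCount E w ^ n =
      ∑ w, placementCount E w ^ n := fun n hn =>
    sum_subset (subset_univ _) fun w _ hw => by rw [placementCount_eq_zero hw, zero_pow hn]
  have hcs : (∑ w ∈ congruentSimplices k E, placementCount E w) ^ 2 ≤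
      #(congruentSimplices k E) * ∑ w ∈ congruentSimplices k E, placementCount E w ^ 2 :=
    sq_sum_le_card_mul_sum_sq
  have h1 := hsub 1 one_ne_zero
  simp only [pow_one] at h1
  rw [hsub 2 two_ne_zero, h1, sum_placementCount, sum_placementCount_sq] at hcs
  have hpos : 0 < #(orthogonalFinset F d) * Fintype.card F ^ d :=
    Nat.mul_pos (card_pos.2 ⟨1, one_mem_orthogonalFinset⟩) (pow_pos Fintype.card_pos _)
  refine Nat.le_of_mul_le_mul_left ?_ hpos
  calc _ = (#(orthogonalFinset F d) * Fintype.card F ^ d * #E ^ (k + 1)) ^ 2 := by ring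
    _ ≤ _ := hcs
    _ = _ := by ring

end

/-! ### Congruence classes -/

section

variable {F : Type u} [Field F] {d k : ℕ}

/-- The edges of the simplex `w` at its vertex `w 0`. -/
def edgeVectors (w : Fin (k + 1) → Fin d → F) : Fin k → Fin d → F := fun i => w i.succ - w 0

theorem edgeVectors_injective (w₀ : Fin d → F) :
    Set.InjOn (edgeVectors (F := F) (d := d) (k := k)) {w | w 0 = w₀} := by
  intro w hw w' hw' h
  funext i
  refine Fin.cases (hw.trans hw'.symm) (fun i => ?_) i
  have := congrFun h i
  simp only [edgeVectors] at this
  rw [hw, hw'] at this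
  exact sub_left_injective this

section
variable [Fintype F]

theorem card_edgeVectors_le (p : (Fin k → Fin d → F) → Prop) [DecidablePred p] :
    #{w : Fin (k + 1) → Fin d → F | p (edgeVectors w)} ≤ Fintype.card F ^ d * #{v | p v} := by
  have : Fintype.card F ^ d = #(univ : Finset (Fin d → F)) := by simp
  rw [this, ← card_product]
  refine card_le_card_of_injOn (fun w => (w 0, edgeVectors w)) ?_ ?_
  · intro w hw
    simpa using hw
  · intro w _ w' _ h
    exact edgeVectors_injective (w' 0) (Prod.ext_iff.1 h).1 rfl (Prod.ext_iff.1 h).2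

theorem SimplexCongruent.edgeVectors_dotProduct_eq {w v : Fin (k + 1) → Fin d → F}
    (h : SimplexCongruent w v) (i j : Fin k) :
    edgeVectors w i ⬝ᵥ edgeVectors w j = edgeVectors v i ⬝ᵥ edgeVectors v j := by
  obtain ⟨θ, hθ, z, hz⟩ := h
  have he : ∀ i, edgeVectors v i = θ *ᵥ edgeVectors w i := fun i => by
    simp only [edgeVectors, ← hz, mulVec_sub, add_sub_add_left_eq_sub]
  rw [he, he, mulVec_dotProduct_mulVec_of_mem_orthogonalFinset
    (mem_orthogonalGroup_iff_mem_orthogonalFinset.1 hθ)]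

theorem mk_mem_image_of_mem_congruentSimplices {E : Finset (Fin d → F)}
    {w : Fin (k + 1) → Fin d → F} (hw : w ∈ congruentSimplices k E) :
    Quotient.mk (simplexSetoid F d k) w ∈
      Quotient.mk (simplexSetoid F d k) '' {x | ∀ i, x i ∈ E} := by
  classical
  simp only [congruentSimplices, mem_filter, mem_univ, true_and] at hw
  obtain ⟨θ, hθ, z, hz⟩ := hw
  refine ⟨fun i => z + θ *ᵥ w i, hz, ?_⟩
  exact (Quotient.sound (s := simplexSetoid F d k)
    ⟨θ, mem_orthogonalGroup_iff_mem_orthogonalFinset.2 hθ, z, fun _ => rfl⟩).symm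

open scoped Classical in
/-- Congruent simplices have edge vectors with the same Gram matrix, so a congruence class contains
few simplices with nondegenerate edge vectors. -/
theorem card_congruentSimplices_mul_le (h2 : (2 : F) ≠ 0) (hkd : k ≤ d) (E : Finset (Fin d → F)) :
    (#{w ∈ congruentSimplices k E | FlagNondegenerate (edgeVectors w)} : ℝ) *
        (Fintype.card F : ℝ) ^ (k + 1).choose 2 ≤
      numSimplexClasses k E * ((if k < d then 1 else 2) * (1 + 4 / (Fintype.card F : ℝ)) ^ k *
        (Fintype.card F : ℝ) ^ (d * (k + 1))) := by
  set q : ℝ := (Fintype.card F : ℝ) with hqd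
  have hq : 0 < q := by rw [hqd]; exact_mod_cast Fintype.card_pos
  have hfin : (Quotient.mk (simplexSetoid F d k) '' {x | ∀ i, x i ∈ E}).Finite := Set.toFinite _
  rw [numSimplexClasses, Set.ncard_eq_toFinset_card _ hfin,
    card_eq_sum_card_fiberwise (f := Quotient.mk (simplexSetoid F d k)) (t := hfin.toFinset)]
  · rw [Nat.cast_sum, sum_mul, ← nsmul_eq_mul]
    refine sum_le_card_nsmul _ _ _ fun c _ => ?_
    rcases Finset.eq_empty_or_nonempty {w ∈ ({w ∈ congruentSimplices k E |
      FlagNondegenerate (edgeVectors w)} : Finset _) | Quotient.mk (simplexSetoid F d k) w = c}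
      with he | ⟨w, hw⟩
    · rw [he, card_empty, Nat.cast_zero, zero_mul]
      split_ifs <;> positivity
    · simp only [mem_filter] at hw
      obtain ⟨⟨-, hflag⟩, rfl⟩ := hw
      have hfib := hflag.card_gram_fiber_mul_le h2 hkd
      have hsub : #{x ∈ ({w ∈ congruentSimplices k E |
          FlagNondegenerate (edgeVectors w)} : Finset _) |
          Quotient.mk (simplexSetoid F d k) x = Quotient.mk (simplexSetoid F d k) w} ≤
          Fintype.card F ^ d * #{v : Fin k → Fin d → F |
            ∀ i j, v i ⬝ᵥ v j = edgeVectors w i ⬝ᵥ edgeVectors w j} := by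
        refine le_trans (card_le_card fun x hx => ?_) (card_edgeVectors_le fun v =>
          ∀ i j, v i ⬝ᵥ v j = edgeVectors w i ⬝ᵥ edgeVectors w j)
        simp only [mem_filter, mem_univ, true_and] at hx ⊢
        have hx : SimplexCongruent x w := Quotient.exact hx.2
        exact hx.edgeVectors_dotProduct_eq
      have hsub := (Nat.cast_le (α := ℝ)).2 hsub
      push_cast at hsub
      refine (mul_le_mul_of_nonneg_right hsub (by positivity)).trans ?_
      rw [mul_assoc]
      refine (mul_le_mul_of_nonneg_left hfib (by positivity)).trans (le_of_eq ?_)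
      ring
  · intro w hw
    rw [hfin.coe_toFinset]
    exact mk_mem_image_of_mem_congruentSimplices (mem_filter.1 hw).1

/-- A set satisfying the size condition has simplices congruent to a positive proportion of all
simplices of the space, and to almost all of them when `δ` is small. -/
theorem pow_le_card_congruentSimplices_mul (h2 : (2 : F) ≠ 0) (hq : 6 ≤ Fintype.card F)
    (hk : 1 ≤ k) {A : Fin d → Finset F} (hA : ∀ i, (A i).Nonempty) (i : Fin d) {δ : ℝ}
    (h : (Fintype.card F : ℝ) ^ (d * k) * #(A i) ≤ δ * (#(Fintype.piFinset A) : ℝ) ^ (k + 1)) :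
    (Fintype.card F : ℝ) ^ (d * (k + 1)) ≤
      #(congruentSimplices k (Fintype.piFinset A)) * (1 + 4 * k ^ 2 * δ) := by
  have hcs := card_mul_pow_le_card_congruentSimplices (Fintype.piFinset A) k
  have hL := sum_sum_congruenceCount_pow_le h2 hq A i hk
  have hE : 0 < #(Fintype.piFinset A) := card_pos.2 (Fintype.piFinset_nonempty.2 hA)
  have hO : 0 < #(orthogonalFinset F d) := card_pos.2 ⟨1, one_mem_orthogonalFinset⟩
  set E := Fintype.piFinset A
  set q : ℝ := (Fintype.card F : ℝ) with hqd
  have hq0 : 0 < q := by rw [hqd]; exact_mod_cast Fintype.card_pos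
  have hcs : (#(orthogonalFinset F d) : ℝ) * q ^ d * (#E : ℝ) ^ (2 * (k + 1)) ≤
      #(congruentSimplices k E) *
        ∑ θ ∈ orthogonalFinset F d, ∑ z, (congruenceCount E θ z : ℝ) ^ (k + 1) := by
    rw [hqd]
    exact_mod_cast hcs
  have hO : (0 : ℝ) < #(orthogonalFinset F d) := by exact_mod_cast hO
  have hE : (0 : ℝ) < #E := by exact_mod_cast hE
  set X : ℝ := (#E : ℝ) ^ (k + 1) with hX
  have hX0 : 0 < X := by positivity
  have hXX : (#E : ℝ) ^ (2 * (k + 1)) = X ^ 2 := by rw [hX, ← pow_mul, mul_comm]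
  rw [hXX] at hcs hL
  have hQ : 0 < q ^ (d * k) := by positivity
  have hXA : X * #(A i) ≤ δ * X ^ 2 / q ^ (d * k) := by
    rw [le_div_iff₀ hQ]
    nlinarith
  have hL' : ∑ θ ∈ orthogonalFinset F d, ∑ z, (congruenceCount E θ z : ℝ) ^ (k + 1) ≤
      #(orthogonalFinset F d) * X ^ 2 / q ^ (d * k) * (1 + 4 * k ^ 2 * δ) := by
    refine hL.trans ?_
    calc _ = #(orthogonalFinset F d) * (X ^ 2 / q ^ (d * k) + 4 * k ^ 2 * (X * #(A i))) := by ring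
      _ ≤ #(orthogonalFinset F d) *
          (X ^ 2 / q ^ (d * k) + 4 * k ^ 2 * (δ * X ^ 2 / q ^ (d * k))) := by gcongr
      _ = _ := by ring
  have hpos : 0 < #(orthogonalFinset F d) * X ^ 2 / q ^ (d * k) := by positivity
  refine le_of_mul_le_mul_left ?_ hpos
  calc #(orthogonalFinset F d) * X ^ 2 / q ^ (d * k) * q ^ (d * (k + 1))
      = #(orthogonalFinset F d) * q ^ d * X ^ 2 := by
        rw [mul_add, mul_one, pow_add]; field_simp
    _ ≤ #(congruentSimplices k E) *
        (#(orthogonalFinset F d) * X ^ 2 / q ^ (d * k) * (1 + 4 * k ^ 2 * δ)) :=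
        hcs.trans (by gcongr)
    _ = _ := by ring

/-- The explicit bound from which the constant and the asymptotic forms follow. -/
theorem numSimplexClasses_lower_bound (h2 : (2 : F) ≠ 0) (hq : 6 ≤ Fintype.card F)
    (hk : 1 ≤ k) (hkd : k ≤ d) {A : Fin d → Finset F} (hA : ∀ i, (A i).Nonempty) (i : Fin d)
    {δ : ℝ} (hδ : 0 ≤ δ)
    (h : (Fintype.card F : ℝ) ^ (d * k) * #(A i) ≤ δ * (#(Fintype.piFinset A) : ℝ) ^ (k + 1)) :
    (1 / (1 + 4 * k ^ 2 * δ) - 2 * k / Fintype.card F) *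
        (Fintype.card F : ℝ) ^ (k + 1).choose 2 ≤
      (if k < d then 1 else 2) * (1 + 4 / (Fintype.card F : ℝ)) ^ k *
        numSimplexClasses k (Fintype.piFinset A) := by
  classical
  have hP := pow_le_card_congruentSimplices_mul h2 hq hk hA i h
  have hgood := card_congruentSimplices_mul_le h2 hkd (Fintype.piFinset A)
  have hbad := card_not_flagNondegenerate_mul_le (F := F) h2 hkd
  have hbad' := card_edgeVectors_le (F := F) (d := d) (k := k) fun v => ¬ FlagNondegenerate v
  set E := Fintype.piFinset A
  set P := congruentSimplices k E
  set q : ℝ := (Fintype.card F : ℝ) with hqd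
  have hq0 : 0 < q := by rw [hqd]; exact_mod_cast Fintype.card_pos
  have hsplit : (#P : ℝ) ≤ #{w ∈ P | FlagNondegenerate (edgeVectors w)} +
      #{w : Fin (k + 1) → Fin d → F | ¬ FlagNondegenerate (edgeVectors w)} := by
    rw [← card_filter_add_card_filter_not (s := P) fun w => FlagNondegenerate (edgeVectors w)]
    push_cast
    gcongr
    exact subset_univ _
  set B := #{w : Fin (k + 1) → Fin d → F | ¬ FlagNondegenerate (edgeVectors w)}
  have hB : (B : ℝ) ≤ 2 * k / q * q ^ (d * (k + 1)) := by
    have hbad : q * (#{v : Fin k → Fin d → F | ¬ FlagNondegenerate v} : ℝ) ≤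
        2 * k * q ^ (d * k) := by
      rw [hqd]
      exact_mod_cast hbad
    have hbad' : (B : ℝ) ≤ q ^ d * #{v : Fin k → Fin d → F | ¬ FlagNondegenerate v} := by
      rw [hqd]
      exact_mod_cast hbad'
    rw [div_mul_eq_mul_div, le_div_iff₀ hq0]
    calc (B : ℝ) * q ≤ q ^ d * #{v : Fin k → Fin d → F | ¬ FlagNondegenerate v} * q := by gcongr
      _ = q ^ d * (q * #{v : Fin k → Fin d → F | ¬ FlagNondegenerate v}) := by ring
      _ ≤ q ^ d * (2 * k * q ^ (d * k)) := by gcongr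
      _ = _ := by ring
  have hW : 0 < q ^ (d * (k + 1)) := by positivity
  have hP' : q ^ (d * (k + 1)) * (1 / (1 + 4 * k ^ 2 * δ)) ≤ #P := by
    rw [mul_one_div, div_le_iff₀ (by positivity)]
    exact hP
  refine le_of_mul_le_mul_left ?_ hW
  calc q ^ (d * (k + 1)) * ((1 / (1 + 4 * k ^ 2 * δ) - 2 * k / q) * q ^ (k + 1).choose 2)
      = (q ^ (d * (k + 1)) * (1 / (1 + 4 * k ^ 2 * δ)) - 2 * k / q * q ^ (d * (k + 1))) *
          q ^ (k + 1).choose 2 := by ring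
    _ ≤ #{w ∈ P | FlagNondegenerate (edgeVectors w)} * q ^ (k + 1).choose 2 := by
        gcongr
        linarith
    _ ≤ _ := hgood
    _ = _ := by ring

theorem two_ne_zero_of_odd_card (h : Odd (Fintype.card F)) : (2 : F) ≠ 0 := by
  intro h2
  have hp : ringChar F = 2 := by
    refine ((Nat.dvd_prime Nat.prime_two).1 (ringChar.dvd (by exact_mod_cast h2))).resolve_left ?_
    exact CharP.ringChar_ne_one
  have := FiniteField.even_card_of_char_two hp
  rw [Nat.odd_iff] at h
  omega

end

theorem numSimplexClasses_pos [Fintype F] {E : Finset (Fin d → F)} (hE : E.Nonempty) :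
    1 ≤ numSimplexClasses k E := by
  obtain ⟨x, hx⟩ := hE
  rw [numSimplexClasses, Nat.one_le_iff_ne_zero, ← Nat.pos_iff_ne_zero,
    Set.ncard_pos (Set.toFinite _)]
  exact ⟨_, fun _ => x, fun _ => hx, rfl⟩

theorem exists_card_eq_iInf {X : Type*} {A : Fin d → Finset X} (hd : 0 < d) :
    ∃ i, #(A i) = (⨅ i, #(A i) : ℕ) := by
  have : Nonempty (Fin d) := ⟨⟨0, hd⟩⟩
  exact exists_eq_ciInf_of_finite

/-- The size condition with a small `δ` forces a large field. -/
theorem one_le_mul_pow_of_pow_le [Fintype F] {A : Fin d → Finset F} (hA : ∀ i, (A i).Nonempty)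
    (i : Fin d) {δ : ℝ} (hδ : 0 ≤ δ)
    (h : (Fintype.card F : ℝ) ^ (d * k) * #(A i) ≤ δ * (#(Fintype.piFinset A) : ℝ) ^ (k + 1)) :
    1 ≤ δ * (Fintype.card F : ℝ) ^ (d - 1) := by
  obtain ⟨n, rfl⟩ : ∃ n, d = n + 1 := ⟨d - 1, by have := i.pos; omega⟩
  rw [Nat.add_sub_cancel]
  set q : ℝ := (Fintype.card F : ℝ) with hqd
  have hq0 : 0 < q := by rw [hqd]; exact_mod_cast Fintype.card_pos
  have hAi : (0 : ℝ) < #(A i) := by exact_mod_cast card_pos.2 (hA i)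
  have hle : ∀ j, (#(A j) : ℝ) ≤ q := fun j => by rw [hqd]; exact_mod_cast card_le_univ (A j)
  have hE : (#(Fintype.piFinset A) : ℝ) ≤ #(A i) * q ^ n := by
    rw [Fintype.card_piFinset, Fin.prod_univ_succAbove _ i]
    push_cast
    gcongr
    exact (prod_le_prod (fun _ _ => Nat.cast_nonneg _) fun j _ => hle _).trans (by simp)
  have hE' : (#(Fintype.piFinset A) : ℝ) ≤ q ^ (n + 1) :=
    hE.trans (by rw [pow_succ']; gcongr; exact hle i)
  refine le_of_mul_le_mul_left ?_ (show 0 < q ^ ((n + 1) * k) * #(A i) by positivity)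
  calc q ^ ((n + 1) * k) * #(A i) * 1 ≤ δ * (#(Fintype.piFinset A) : ℝ) ^ (k + 1) := by
        rw [mul_one]; exact h
    _ = δ * ((#(Fintype.piFinset A) : ℝ) ^ k * #(Fintype.piFinset A)) := by rw [pow_succ]
    _ ≤ δ * ((q ^ (n + 1)) ^ k * (#(A i) * q ^ n)) := by gcongr
    _ = _ := by rw [← pow_mul]; ring

theorem exists_uniform_coefficient_bound (k : ℕ) {ε : ℝ} (hε : 0 < ε) :
    ∃ η : ℝ, 0 < η ∧ η ≤ 1 / 6 ∧ ∀ δ t : ℝ, 0 ≤ δ → 0 ≤ t → δ ≤ η → t ≤ η →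
      (1 - ε) * (1 + 4 * t) ^ k ≤ 1 / (1 + 4 * k ^ 2 * δ) - 2 * k * t := by
  let f : ℝ × ℝ → ℝ := fun p =>
    1 / (1 + 4 * k ^ 2 * p.1) - 2 * k * p.2 - (1 - ε) * (1 + 4 * p.2) ^ k
  have hf : ContinuousAt f (0, 0) := by
    refine ContinuousAt.sub (ContinuousAt.sub (ContinuousAt.div₀ (by fun_prop) (by fun_prop) ?_)
      (by fun_prop)) (by fun_prop)
    simp
  have hpos : ∀ᶠ p in nhds ((0, 0) : ℝ × ℝ), 0 < f p := by
    refine hf.eventually (lt_mem_nhds ?_)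
    simpa [f] using hε
  obtain ⟨r, hr, hball⟩ := Metric.eventually_nhds_iff.1 hpos
  refine ⟨min (r / 2) (1 / 6), by positivity, min_le_right _ _, fun δ t hδ ht hδη htη => ?_⟩
  have hdist : dist ((δ, t) : ℝ × ℝ) (0, 0) < r := by
    have h1 := hδη.trans (min_le_left _ _)
    have h2 := htη.trans (min_le_left _ _)
    simp only [Prod.dist_eq, dist_zero_right, Real.norm_eq_abs, abs_of_nonneg hδ, abs_of_nonneg ht]
    exact max_lt (by linarith) (by linarith)
  have := hball hdist
  simp only [f] at this
  linarith

/-- The asymptotic bound for `k < d` and `k = d` at once. -/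
theorem exists_asymptotic_lower_bound (hk : 1 ≤ k) (hkd : k ≤ d) {ε : ℝ} (hε : 0 < ε) :
    ∃ δ : ℝ, 0 < δ ∧ ∀ (F : Type u) [Field F] [Fintype F] (A : Fin d → Finset F),
      Odd (Fintype.card F) → (∀ i, (A i).Nonempty) →
      (Fintype.card F : ℝ) ^ (k * d) ≤
        δ * (((Fintype.piFinset A).card : ℝ) ^ (k + 1) / ((⨅ i, (A i).card : ℕ) : ℝ)) →
      (1 - ε) * (Fintype.card F : ℝ) ^ ((k + 1).choose 2) ≤
        (if k < d then 1 else 2) * (numSimplexClasses k (Fintype.piFinset A) : ℝ) := by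
  obtain ⟨η, hη0, hη6, hη⟩ : ∃ η : ℝ, 0 < η ∧ η ≤ 1 / 6 ∧ ∀ δ t : ℝ, 0 ≤ δ → 0 ≤ t → δ ≤ η →
      t ≤ η → (1 - ε) * (1 + 4 * t) ^ k ≤ 1 / (1 + 4 * k ^ 2 * δ) - 2 * k * t :=
    exists_uniform_coefficient_bound k hε
  -- With `δ = η ^ d`, the inequality `1 ≤ δ * q ^ (d - 1)` forces `1 ≤ η * q`, also if `d = 1`.
  refine ⟨η ^ d, by positivity, fun F _ _ A hodd hA h => ?_⟩
  obtain ⟨i, hi⟩ := exists_card_eq_iInf (A := A) (by omega)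
  have hAi : (0 : ℝ) < #(A i) := by exact_mod_cast card_pos.2 (hA i)
  rw [← hi, mul_div_assoc', le_div_iff₀ hAi, mul_comm k d] at h
  have hlarge := one_le_mul_pow_of_pow_le hA i (by positivity) h
  set q : ℝ := (Fintype.card F : ℝ) with hqd
  have hq0 : 0 < q := by rw [hqd]; exact_mod_cast Fintype.card_pos
  have hηq : 1 ≤ η * q := by
    by_contra! hlt
    obtain ⟨n, rfl⟩ : ∃ n, d = n + 1 := ⟨d - 1, by omega⟩
    rw [Nat.add_sub_cancel, pow_succ', mul_assoc, ← mul_pow] at hlarge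
    have := mul_le_one₀ (show η ≤ 1 by linarith) (by positivity)
      (pow_le_one₀ (n := n) (by positivity) hlt.le)
    have h1 : (η * q) ^ n ≤ 1 := pow_le_one₀ (by positivity) hlt.le
    nlinarith
  have ht : 1 / q ≤ η := by rw [div_le_iff₀ hq0]; exact hηq
  have hq6 : 6 ≤ Fintype.card F := by
    have : (6 : ℝ) ≤ q := by nlinarith
    rw [hqd] at this
    exact_mod_cast this
  have hδη : η ^ d ≤ η := pow_le_of_le_one hη0.le (by linarith) (by omega)
  have hmain := numSimplexClasses_lower_bound (two_ne_zero_of_odd_card hodd) hq6 hk hkd hA i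
    (by positivity) h
  have hcoef := hη (η ^ d) (1 / q) (by positivity) (by positivity) hδη ht
  rw [mul_one_div, mul_one_div] at hcoef
  have hpow : 0 < (1 + 4 / q) ^ k := by positivity
  refine le_of_mul_le_mul_left ?_ hpow
  calc (1 + 4 / q) ^ k * ((1 - ε) * q ^ (k + 1).choose 2)
      = (1 - ε) * (1 + 4 / q) ^ k * q ^ (k + 1).choose 2 := by ring
    _ ≤ (1 / (1 + 4 * k ^ 2 * η ^ d) - 2 * k / q) * q ^ (k + 1).choose 2 := by gcongr
    _ ≤ _ := hmain
    _ = _ := by ring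

end

theorem mainTheorem1 (d k : ℕ) (hk : 1 ≤ k) (hkd : k ≤ d) :
    (∀ C : ℝ, 0 < C → ∃ c : ℝ, 0 < c ∧
      ∀ (F : Type u) [Field F] [Fintype F] (A : Fin d → Finset F),
        Odd (Fintype.card F) → (∀ i, (A i).Nonempty) →
        C * (Fintype.card F : ℝ) ^ (k * d) ≤
          ((⨅ i, (A i).card : ℕ) : ℝ)⁻¹ * ((Fintype.piFinset A).card : ℝ) ^ (k + 1) →
        c * (Fintype.card F : ℝ) ^ ((k + 1).choose 2) ≤
          (numSimplexClasses k (Fintype.piFinset A) : ℝ)) ∧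
    (k < d → ∀ ε : ℝ, 0 < ε → ∃ δ : ℝ, 0 < δ ∧
      ∀ (F : Type u) [Field F] [Fintype F] (A : Fin d → Finset F),
        Odd (Fintype.card F) → (∀ i, (A i).Nonempty) →
        (Fintype.card F : ℝ) ^ (k * d) ≤
          δ * (((Fintype.piFinset A).card : ℝ) ^ (k + 1) / ((⨅ i, (A i).card : ℕ) : ℝ)) →
        (1 - ε) * (Fintype.card F : ℝ) ^ ((k + 1).choose 2) ≤
          (numSimplexClasses k (Fintype.piFinset A) : ℝ)) ∧
    (k = d → ∀ ε : ℝ, 0 < ε → ∃ δ : ℝ, 0 < δ ∧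
      ∀ (F : Type u) [Field F] [Fintype F] (A : Fin d → Finset F),
        Odd (Fintype.card F) → (∀ i, (A i).Nonempty) →
        (Fintype.card F : ℝ) ^ (k * d) ≤
          δ * (((Fintype.piFinset A).card : ℝ) ^ (k + 1) / ((⨅ i, (A i).card : ℕ) : ℝ)) →
        (1 / 2 - ε) * (Fintype.card F : ℝ) ^ ((k + 1).choose 2) ≤
          (numSimplexClasses k (Fintype.piFinset A) : ℝ)) := by
  refine ⟨fun C hC => ?_, fun hlt ε hε => ?_, fun heq ε hε => ?_⟩
  · set D : ℝ := 1 + 4 * k ^ 2 * (1 / C) with hD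
    have hD1 : 1 ≤ D := by rw [hD]; have : 0 ≤ 4 * (k : ℝ) ^ 2 * (1 / C) := by positivity
                           linarith
    -- For `q ≥ Q` the degenerate simplices take up at most half of the bound. Smaller fields are
    -- absorbed by the constant, because there is at least one class.
    set Q : ℝ := 4 * k * D + 6 with hQ
    have hQ0 : 0 < Q := by positivity
    refine ⟨min (1 / (2 * D * (2 * 5 ^ k))) (1 / Q ^ (k + 1).choose 2), by positivity,
      fun F _ _ A hodd hA h => ?_⟩
    obtain ⟨i, hi⟩ := exists_card_eq_iInf (A := A) (by omega)
    have hAi : (0 : ℝ) < #(A i) := by exact_mod_cast card_pos.2 (hA i)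
    rw [← hi, inv_mul_eq_div, le_div_iff₀ hAi, mul_comm k d, mul_assoc] at h
    have h' : (Fintype.card F : ℝ) ^ (d * k) * #(A i) ≤
        1 / C * (#(Fintype.piFinset A) : ℝ) ^ (k + 1) := by
      rw [one_div, inv_mul_eq_div, le_div_iff₀ hC, mul_comm]
      exact h
    set q : ℝ := (Fintype.card F : ℝ) with hqd
    have hq1 : 1 ≤ q := by rw [hqd]; exact_mod_cast Fintype.card_pos
    have hq0 : 0 < q := by linarith
    set T : ℝ := (numSimplexClasses k (Fintype.piFinset A) : ℝ)
    rcases le_total Q q with hQq | hqQ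
    · have hq6 : 6 ≤ Fintype.card F := by
        have : (6 : ℝ) ≤ q := by
          have : (0 : ℝ) ≤ 4 * k * D := by positivity
          linarith
        rw [hqd] at this
        exact_mod_cast this
      have hmain := numSimplexClasses_lower_bound (two_ne_zero_of_odd_card hodd) hq6 hk hkd hA i
        (by positivity) h'
      rw [← hD, ← hqd] at hmain
      have hc : 1 / (2 * D) ≤ 1 / D - 2 * k / q := by
        have : 2 * k / q ≤ 1 / (2 * D) := by
          rw [div_le_div_iff₀ hq0 (by positivity)]
          linarith
        have : 1 / D = 1 / (2 * D) + 1 / (2 * D) := by field_simp; norm_num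
        linarith
      have hup : (if k < d then (1 : ℝ) else 2) * (1 + 4 / q) ^ k ≤ 2 * 5 ^ k := by
        have h5 : 1 + 4 / q ≤ 5 := by
          have : 4 / q ≤ 4 := div_le_self (by norm_num) hq1
          linarith
        have h12 : (if k < d then (1 : ℝ) else 2) ≤ 2 := by split_ifs <;> norm_num
        gcongr
      have hpos : (0 : ℝ) < 2 * 5 ^ k := by positivity
      refine le_of_mul_le_mul_left ?_ hpos
      calc 2 * 5 ^ k * (min (1 / (2 * D * (2 * 5 ^ k))) (1 / Q ^ (k + 1).choose 2) *
            q ^ (k + 1).choose 2)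
          ≤ 2 * 5 ^ k * (1 / (2 * D * (2 * 5 ^ k)) * q ^ (k + 1).choose 2) := by
            gcongr
            exact min_le_left _ _
        _ = 1 / (2 * D) * q ^ (k + 1).choose 2 := by field_simp
        _ ≤ (1 / D - 2 * k / q) * q ^ (k + 1).choose 2 := by gcongr
        _ ≤ _ := hmain
        _ ≤ _ := by gcongr
    · have hT : (1 : ℝ) ≤ T :=
        Nat.one_le_cast.2 (numSimplexClasses_pos (Fintype.piFinset_nonempty.2 hA))
      calc _ ≤ 1 / Q ^ (k + 1).choose 2 * q ^ (k + 1).choose 2 := by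
            gcongr
            exact min_le_right _ _
        _ ≤ 1 / Q ^ (k + 1).choose 2 * Q ^ (k + 1).choose 2 := by gcongr
        _ = 1 := by field_simp
        _ ≤ T := hT
  · obtain ⟨δ, hδ, h⟩ := exists_asymptotic_lower_bound hk hkd hε
    refine ⟨δ, hδ, fun F _ _ A hodd hA hle => ?_⟩
    simpa [hlt] using h F A hodd hA hle
  · obtain ⟨δ, hδ, h⟩ := exists_asymptotic_lower_bound hk hkd hε
    refine ⟨δ, hδ, fun F _ _ A hodd hA hle => ?_⟩
    have := h F A hodd hA hle
    rw [if_neg heq.not_lt] at this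
    have hp : 0 ≤ ε * (Fintype.card F : ℝ) ^ (k + 1).choose 2 := by positivity
    linarith
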